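/- \textbf{Model.} The state $\omega\in[0,1]$ is drawn from a prior $\mu_F$ with a strictly positive density. Receiver has actions $a_0,\dots,a_{n-1}$, and there are cutoffs $0=\gamma_0\le\gamma_1\le\cdots\le\gamma_n=1$, at least one of which lies in the open interval $(0,1)$, such that $a_i$ is optimal for Receiver if and only if the posterior mean of the state lies in $[\gamma_i,\gamma_{i+1}]$. Sender's payoff $v(a_i)$ depends only on the action, is strictly increasing in $i$, and $v(a_0)=0$. In state $\omega$ Sender can send any nonempty closed set $m\subseteq[0,1]$ with $\omega\in m$; let $\mathcal C$ be the space of nonempty closed subsets of $[0,1]$ with the Hausdorff distance. A profile consists of (measurable) maps $\sigma:[0,1]\to\Delta(\mathcal C)$, $\tau:\mathcal C\to\Delta(\{a_0,\dots,a_{n-1}\})$ and $p:\mathcal C\to\Delta([0,1])$. It is an \emph{equilibrium} if (1) in every state $\omega$, $\sigma(\omega)$ puts probability one on messages that contain $\omega$ and maximize $v(\tau(m'))$ (the expected payoff) over all messages $m'\ni\omega$; (2) for every $m$, $\tau(a_i\mid m)>0$ implies that the mean of $p(m)$ lies in $[\gamma_i,\gamma_{i+1}]$; (3) $p(m)$ is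 supported on $m$ for every $m$; (4) $p$ is obtained from $\mu_F$ and $\sigma$ by Bayes' rule. A \emph{Sender's preferred equilibrium} is an equilibrium with the highest ex ante payoff of Sender among all equilibria. An equilibrium \emph{features unraveling} if Sender sends the message $\{\omega\}$ in every state $\omega$. A \emph{deterministic representation} is a family $\{B_i\}_{i=0}^{n-1}$ of (possibly empty) closed subsets of $[0,1]$ with $\bigcup_i B_i=[0,1]$ and $\mu_F(B_i\cap B_j)=0$ for $i\ne j$. It is \emph{laminar} if $B_i=\mathrm{cl}\bigl(\mathrm{conv}(B_i)\setminus\bigcup_{k<i}\mathrm{conv}(B_k)\bigr)$ for every $i$. An equilibrium $(\sigma,\tau,p)$ is an \emph{obedient recommendation equilibrium} (ORE) with associated representation $\{B_i\}$ if for every $i$: $\sigma(B_i\mid\omega)=1$ for all $\omega\in B_i\setminus\bigcup_{j>i}B_j$, and $\tau(a_i\mid B_i)=1$ whenever $B_i\neq\varnothing$. \textbf{Proposition.} There exists a Sender's preferred equilibrium which is an ORE such that (i) the associated deterministic representation $\{B_i\}_{i=0}^{n-1}$ can be taken to be laminar and, with $j=\min\{i:\mathrm{int}(B_i)\ne\varnothing\}$,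 to satisfy: (a) $B_j$ is an interval, and for each $k>j$ the set $B_k$ is the union of at most $n-1$ disjoint intervals; (b) $\mathbb E[\omega\mid\omega\in B_j]\in[\gamma_j,\gamma_{j+1})$, and $\mathbb E[\omega\mid\omega\in B_k]=\gamma_k$ for every $k>j$ such that $\mathrm{int}(B_k)\neq\varnothing$ (that is, $a_k$ is not skipped); (ii) Sender's ex ante payoff in this equilibrium is strictly higher than in any equilibrium that features unraveling. -/

import Mathlib

open MeasureTheory ProbabilityTheory

namespace VerifiableDisclosure

noncomputable section

/-- The state space `[0,1]`. -/
abbrev State : Type := unitInterval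

/-- Messages: the nonempty closed subsets of `[0,1]` (closed and compact agree here), with the
topology of the Hausdorff distance. -/
abbrev Message : Type := TopologicalSpace.NonemptyCompacts State

/-- Messages carry the Borel sigma-algebra of the Hausdorff distance. -/
instance instMeasurableSpaceMessage : MeasurableSpace Message := borel Message

instance instBorelSpaceMessage : BorelSpace Message := ⟨rfl⟩

/-- The primitives of a verifiable disclosure game with `n` actions `a_0, …, a_{n-1}`: a prior
with a strictly positive density on `[0,1]`, the cutoffs `0 = γ_0 ≤ γ_1 ≤ ⋯ ≤ γ_n = 1`, and
Sender's payoff `v`, strictly increasing in the action and normalized by `v(a_0) = 0`. -/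
structure Game (n : ℕ) where
  /-- the density of the prior -/
  density : State → ℝ
  measurable_density : Measurable density
  density_pos : ∀ ω, 0 < density ω
  lintegral_density : ∫⁻ ω, ENNReal.ofReal (density ω) = 1
  /-- the cutoffs -/
  cutoff : Fin (n + 1) → ℝ
  cutoff_mono : Monotone cutoff
  cutoff_zero : cutoff 0 = 0
  cutoff_last : cutoff (Fin.last n) = 1
  /-- Sender's payoff from each action of Receiver -/
  payoff : Fin n → ℝ
  payoff_strictMono : StrictMono payoff
  payoff_zero : ∀ i : Fin n, (i : ℕ) = 0 → payoff i = 0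

namespace Game

variable {n : ℕ} (G : Game n)

/-- The prior `μ_F`. -/
def prior : Measure State :=
  (volume : Measure State).withDensity fun ω => ENNReal.ofReal (G.density ω)

instance instIsProbabilityMeasurePrior : IsProbabilityMeasure G.prior :=
  ⟨by rw [prior, withDensity_apply _ MeasurableSet.univ, Measure.restrict_univ,
    G.lintegral_density]⟩

/-- Action `a_i` is optimal for Receiver iff the posterior mean lies in
`A_i = [γ_i, γ_{i+1}]`. -/
def optimalRegion (i : Fin n) : Set ℝ := Set.Icc (G.cutoff i.castSucc) (G.cutoff i.succ)

/-- The conditional mean `E[ω | ω ∈ B]` under the prior. -/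
def condMean (B : Set State) : ℝ := ∫ ω, (ω : ℝ) ∂(G.prior[|B])

end Game

/-- A strategy of Sender, a strategy of Receiver and a belief system of Receiver. All three are
Markov kernels, i.e. measurable maps into the respective spaces of probability measures. -/
structure Profile (n : ℕ) where
  /-- Sender's strategy `σ` -/
  sender : Kernel State Message
  /-- Receiver's strategy `τ` -/
  receiver : Kernel Message (Fin n)
  /-- Receiver's beliefs `p` -/
  belief : Kernel Message State
  sender_markov : IsMarkovKernel sender
  receiver_markov : IsMarkovKernel receiver
  belief_markov : IsMarkovKernel belief

namespace Profile

variable {n : ℕ} (e : Profile n) (G : Game n)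

/-- Sender's expected payoff `v(τ(m))` from sending message `m`. -/
def messageValue (m : Message) : ℝ := ∑ i, (e.receiver m).real {i} * G.payoff i

/-- The posterior mean of the state after message `m`. -/
def posteriorMean (m : Message) : ℝ := ∫ ω, (ω : ℝ) ∂(e.belief m)

/-- Sender's ex ante payoff. -/
def exAntePayoff : ℝ := ∫ ω, ∫ m, e.messageValue G m ∂(e.sender ω) ∂G.prior

/-- Perfect Bayesian equilibrium of the verifiable disclosure game. -/
structure IsEquilibrium : Prop where
  /-- only messages containing the true state are sent -/
  verifiable : ∀ ω : State, ∀ᵐ m ∂(e.sender ω), ω ∈ m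
  /-- Sender only sends messages that are optimal among those containing the true state -/
  sender_optimal : ∀ ω : State, ∀ᵐ m ∂(e.sender ω),
    ∀ m' : Message, ω ∈ m' → e.messageValue G m' ≤ e.messageValue G m
  /-- Receiver only uses actions that are optimal given the beliefs, after every message -/
  receiver_optimal : ∀ (m : Message) (i : Fin n),
    0 < e.receiver m {i} → e.posteriorMean m ∈ G.optimalRegion i
  /-- after message `m`, states outside `m` are deemed impossible -/
  belief_support : ∀ m : Message, e.belief m (m : Set State)ᶜ = 0
  /-- Bayes' rule: `p` is a conditional distribution of the state given the message, under the
  joint distribution of states and messages generated by the prior and `σ` -/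
  bayes : (e.sender ∘ₘ G.prior) ⊗ₘ e.belief = (G.prior ⊗ₘ e.sender).map Prod.swap

/-- A Sender's preferred equilibrium: one with the highest ex ante payoff for Sender among all
equilibria. -/
def IsSenderPreferred : Prop :=
  e.IsEquilibrium G ∧ ∀ e' : Profile n, e'.IsEquilibrium G → e'.exAntePayoff G ≤ e.exAntePayoff G

/-- An equilibrium that features unraveling: Sender fully reveals every state. -/
def IsUnraveling : Prop :=
  e.IsEquilibrium G ∧ ∀ ω : State, e.sender ω = Measure.dirac ({ω} : Message)

end Profile

section Representations

variable {n : ℕ} (G : Game n) (B : Fin n → Set State)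

/-- A deterministic representation: closed sets (possibly empty) that cover `[0,1]` and overlap
only in null sets. -/
structure IsDeterministicRepresentation : Prop where
  isClosed : ∀ i, IsClosed (B i)
  covers : ⋃ i, B i = Set.univ
  overlap_null : ∀ i j, i ≠ j → G.prior (B i ∩ B j) = 0

/-- `e` is an obedient recommendation equilibrium with associated deterministic representation
`B`: in states in `B_i` outside all `B_j` with `j > i` the message `B_i` is sent with probability
one, and after the message `B_i` (if nonempty, so that it is a message) action `a_i` is played
with probability one. -/
structure IsOREWith (e : Profile n) : Prop where
  equilibrium : e.IsEquilibrium G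
  representation : IsDeterministicRepresentation G B
  sender_recommends : ∀ (i : Fin n) (ω : State), ω ∈ B i \ ⋃ j > i, B j →
    e.sender ω {m : Message | (m : Set State) = B i} = 1
  receiver_obeys : ∀ (i : Fin n) (m : Message), (m : Set State) = B i → e.receiver m {i} = 1

/-- The convex hull of a subset of `[0,1]`, as a subset of `[0,1]`. -/
def hull (S : Set State) : Set State :=
  {x | (x : ℝ) ∈ convexHull ℝ ((fun y : State => (y : ℝ)) '' S)}

/-- A laminar representation: `B_i = cl (conv B_i \ ⋃_{k < i} conv B_k)` for every `i`. -/
def IsLaminar : Prop :=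
  ∀ i, B i = closure (hull (B i) \ ⋃ k < i, hull (B k))

/-- `S` is the union of at most `N` pairwise disjoint (nonempty) intervals. -/
def IsUnionOfDisjointIntervals (N : ℕ) (S : Set State) : Prop :=
  ∃ m ≤ N, ∃ J : Fin m → Set State,
    (∀ s, (J s).Nonempty ∧ (J s).OrdConnected) ∧
    (∀ s t, s ≠ t → Disjoint (J s) (J t)) ∧ S = ⋃ s, J s

end Representations

end

end VerifiableDisclosure

namespace VerifiableDisclosure

noncomputable section

open Set Filter Topology

/-! The equilibrium problem is replaced by a relaxed one over kernels from states to actions. A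
kernel is feasible if the choosers of each `a_k` have mean at least the lower cutoff of `a_k`, and
almost no state above the upper cutoff of `a_k` chooses it. Every equilibrium induces such a kernel:
break Receiver's ties in Sender's favor; Bayes' rule gives the mean condition, and the option of
disclosing the state gives the other. The induced value is at least Sender's payoff
(`isFeasible_inducedKernel`, `exAntePayoff_le`).

Weak compactness of the joint laws yields a feasible kernel of maximal value and, among those, of
maximal `spread` (`exists_isLexOptimal`). Exchange arguments then give its shape. If a lower action
is chosen, the surplus of a higher one is zero, or some choosers could be promoted
(`surplus_eq_zero`). If choosers of a higher action lay between choosers of a lower one, a swap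
preserving mass and mean would leave the value unchanged and raise the convex secondary objective
(`choosers_Icc`). Choosers of `a_0` lie to the left of all others, because the mean condition does
not bind for `a_0` (`choosers_Iic`).

Consequently the supports of the choosers are closed, cover the state space, overlap in finitely
many points and are nested, which gives laminarity and the count of intervals (`IsNestedCover`).
Recommending these sets, with skeptical beliefs after any other message, is an equilibrium attaining
the relaxed optimum (`exists_isOREWith`), so it is Sender's preferred. Unraveling induces the full
disclosure kernel; an interior cutoff leaves a positive surplus above a chosen action, so that
kernel is not optimal. -/

/-- The probability that a randomized choice of actions `κ` assigns to action `a_k` in state `ω`. -/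
def share {n : ℕ} (κ : Kernel State (Fin n)) (k : Fin n) (ω : State) : ℝ := (κ ω).real {k}

/-! ### Kernels into finitely many actions -/

section Share

variable {n : ℕ} (κ : Kernel State (Fin n))

lemma measurable_share (k : Fin n) : Measurable (share κ k) :=
  (κ.measurable_coe (measurableSet_singleton k)).ennreal_toReal

lemma share_nonneg (k : Fin n) (ω : State) : 0 ≤ share κ k ω := measureReal_nonneg

lemma share_le_one [IsMarkovKernel κ] (k : Fin n) (ω : State) : share κ k ω ≤ 1 :=
  measureReal_le_one

lemma sum_share [IsMarkovKernel κ] (ω : State) : ∑ k, share κ k ω = 1 := by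
  simp [share]

lemma integrable_of_bounded {μ : Measure State} [IsFiniteMeasure μ] {f : State → ℝ}
    (hf : Measurable f) (C : ℝ) (hC : ∀ ω, |f ω| ≤ C) : Integrable f μ :=
  Integrable.of_bound hf.aestronglyMeasurable C (Eventually.of_forall hC)

lemma integrable_share_mul [IsMarkovKernel κ] {μ : Measure State} [IsFiniteMeasure μ] (k : Fin n)
    {f : State → ℝ} (hf : Measurable f) (C : ℝ) (hC : ∀ ω, |f ω| ≤ C) :
    Integrable (fun ω => share κ k ω * f ω) μ := by
  refine integrable_of_bounded ((measurable_share κ k).mul hf) C fun ω => ?_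
  rw [abs_mul, abs_of_nonneg (share_nonneg κ k ω)]
  exact (mul_le_of_le_one_left (abs_nonneg _) (share_le_one κ k ω)).trans (hC ω)

lemma integrable_share [IsMarkovKernel κ] {μ : Measure State} [IsFiniteMeasure μ] (k : Fin n) :
    Integrable (share κ k) μ := by
  simpa using integrable_share_mul κ k (f := fun _ => 1) measurable_const 1 (by simp)

lemma integral_compProd_eq_sum_share [IsMarkovKernel κ] {μ : Measure State} [IsFiniteMeasure μ]
    {g : State × Fin n → ℝ} (hg : Integrable g (μ ⊗ₘ κ)) :
    ∫ x, g x ∂(μ ⊗ₘ κ) = ∫ ω, ∑ k, share κ k ω * g (ω, k) ∂μ := by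
  rw [Measure.integral_compProd hg]
  congr 1 with ω
  rw [integral_fintype .of_finite]
  simp [share]

end Share

/-- The choice of actions with prescribed probabilities. -/
def kernelOfShares {n : ℕ} (α : Fin n → State → ℝ) (hα : ∀ k, Measurable (α k)) :
    Kernel State (Fin n) where
  toFun ω := ∑ k, ENNReal.ofReal (α k ω) • Measure.dirac k
  measurable' := by
    refine Measure.measurable_of_measurable_coe _ fun s hs => ?_
    simp only [Measure.coe_finsetSum, Finset.sum_apply, Measure.smul_apply, smul_eq_mul]
    exact Finset.measurable_sum _ fun k _ => (hα k).ennreal_ofReal.mul_const _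

section KernelOfShares

variable {n : ℕ} {α : Fin n → State → ℝ} (hα : ∀ k, Measurable (α k))

lemma share_kernelOfShares (h0 : ∀ k ω, 0 ≤ α k ω) (k : Fin n) (ω : State) :
    share (kernelOfShares α hα) k ω = α k ω := by
  simp only [share, kernelOfShares, Kernel.coe_mk, Measure.real, Measure.coe_finsetSum,
    Finset.sum_apply, Measure.smul_apply, smul_eq_mul]
  rw [Finset.sum_eq_single k]
  · simp [ENNReal.toReal_ofReal (h0 k ω)]
  · intro b _ hb
    simp [hb]
  · simp

lemma isMarkovKernel_kernelOfShares (h0 : ∀ k ω, 0 ≤ α k ω) (h1 : ∀ ω, ∑ k, α k ω = 1) :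
    IsMarkovKernel (kernelOfShares α hα) := by
  refine ⟨fun ω => ⟨?_⟩⟩
  simp only [kernelOfShares, Kernel.coe_mk, Measure.coe_finsetSum,
    Finset.sum_apply, Measure.smul_apply, smul_eq_mul, measure_univ, mul_one]
  rw [← ENNReal.ofReal_sum_of_nonneg fun k _ => h0 k ω, h1, ENNReal.ofReal_one]

end KernelOfShares

/-- A relatively open set may contain an endpoint of the interval; by density it also meets the open
interval, where Lebesgue measure on the line applies. -/
instance isOpenPosMeasure_volume_state : (volume : Measure State).IsOpenPosMeasure := by
  refine ⟨fun U hU hne => ?_⟩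
  obtain ⟨V, hV, rfl⟩ := isOpen_induced_iff.1 hU
  have hd : Dense (Ioo (0 : State) 1) := by
    rw [dense_iff_closure_eq, closure_Ioo zero_ne_one]
    exact eq_univ_of_forall fun x => ⟨x.2.1, x.2.2⟩
  obtain ⟨x, hxV, hx⟩ := hd.inter_open_nonempty _ hU hne
  have hpos : 0 < volume (V ∩ Ioo (0 : ℝ) 1) :=
    (hV.inter isOpen_Ioo).measure_pos volume ⟨x, hxV, hx⟩
  refine (hpos.trans_le ?_).ne'
  rw [unitInterval.volume_apply]
  refine measure_mono fun y hy => ?_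
  exact ⟨⟨y, hy.2.1.le, hy.2.2.le⟩, hy.1, rfl⟩

/-! ### The prior, the relaxed problem and existence of an optimum -/

namespace Game

variable {n : ℕ} (G : Game n)

lemma volume_absolutelyContinuous_prior : (volume : Measure State) ≪ G.prior :=
  withDensity_absolutelyContinuous' G.measurable_density.ennreal_ofReal.aemeasurable
    (Eventually.of_forall fun ω => by simpa using G.density_pos ω)

instance isOpenPosMeasure_prior : G.prior.IsOpenPosMeasure :=
  G.volume_absolutelyContinuous_prior.isOpenPosMeasure

instance nullSingletonClass_prior : NullSingletonClass G.prior where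
  measure_singleton x :=
    (withDensity_absolutelyContinuous (volume : Measure State) _) (measure_singleton x)

lemma cutoff_nonneg (k : Fin (n + 1)) : 0 ≤ G.cutoff k := by
  rw [← G.cutoff_zero]; exact G.cutoff_mono (Fin.zero_le k)

lemma cutoff_le_one (k : Fin (n + 1)) : G.cutoff k ≤ 1 := by
  rw [← G.cutoff_last]; exact G.cutoff_mono (Fin.le_last k)

lemma neZero (G : Game n) : NeZero n := by
  refine ⟨?_⟩
  rintro rfl
  have h0 := G.cutoff_zero
  have h1 := G.cutoff_last
  simp only [Fin.last_zero, Fin.isValue] at h1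
  linarith

lemma abs_state_sub_cutoff_le (k : Fin (n + 1)) (ω : State) : |(ω : ℝ) - G.cutoff k| ≤ 1 := by
  rw [abs_le]
  have := G.cutoff_nonneg k
  have := G.cutoff_le_one k
  have := ω.2.1
  have := ω.2.2
  constructor <;> linarith

/-- The surplus of action `a_k`: the mass of states choosing `a_k`, weighted by the distance to the
lower cutoff of `a_k`. -/
def surplus (κ : Kernel State (Fin n)) (k : Fin n) : ℝ :=
  ∫ ω, share κ k ω * ((ω : ℝ) - G.cutoff k.castSucc) ∂G.prior

/-- Choices of actions that are obedient for the Receiver and robust to full disclosure. -/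
structure IsFeasible (κ : Kernel State (Fin n)) : Prop where
  surplus_nonneg : ∀ k, 0 ≤ G.surplus κ k
  share_eq_zero : ∀ k, ∀ᵐ ω : State ∂G.prior, G.cutoff k.succ < (ω : ℝ) → share κ k ω = 0

/-- Sender's expected payoff from a choice of actions. -/
def value (κ : Kernel State (Fin n)) : ℝ := ∫ ω, ∑ k, share κ k ω * G.payoff k ∂G.prior

/-- A secondary objective, which rewards spreading the states that choose higher actions. -/
def spread (κ : Kernel State (Fin n)) : ℝ :=
  ∫ ω, ∑ k, share κ k ω * ((k : ℝ) * (ω : ℝ) ^ 2) ∂G.prior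

/-- Feasible choices of actions of maximal value. -/
def IsValueMaximal (κ : Kernel State (Fin n)) : Prop :=
  G.IsFeasible κ ∧ ∀ κ' : Kernel State (Fin n), IsMarkovKernel κ' → G.IsFeasible κ' →
    G.value κ' ≤ G.value κ

/-- Feasible choices of actions of maximal value and, among those, of maximal spread. -/
def IsLexOptimal (κ : Kernel State (Fin n)) : Prop :=
  G.IsValueMaximal κ ∧ ∀ κ' : Kernel State (Fin n), IsMarkovKernel κ' → G.IsFeasible κ' →
    G.value κ' = G.value κ → G.spread κ' ≤ G.spread κ

/-- Functions on `State × Fin n` vanishing off one slice. -/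
def sliceMap (k : Fin n) (f : C(State, ℝ)) : C(State × Fin n, ℝ) where
  toFun x := if x.2 = k then f x.1 else 0
  continuous_toFun := by
    have h : Continuous fun a : Fin n => if a = k then (1 : ℝ) else 0 :=
      continuous_of_discreteTopology
    have := (h.comp (continuous_snd (X := State))).mul (f.continuous.comp continuous_fst)
    refine this.congr fun x => ?_
    simp

lemma integral_sliceMap (κ : Kernel State (Fin n)) [IsMarkovKernel κ] (k : Fin n)
    (f : C(State, ℝ)) :
    ∫ x, sliceMap k f x ∂(G.prior ⊗ₘ κ) = ∫ ω, share κ k ω * f ω ∂G.prior := by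
  rw [integral_compProd_eq_sum_share κ
    ((sliceMap k f).continuous.integrable_of_hasCompactSupport (HasCompactSupport.of_compactSpace _))]
  simp [sliceMap]

/-- The objective functions of the relaxed problem. -/
def objectiveMap (c : Fin n → C(State, ℝ)) : C(State × Fin n, ℝ) := ∑ k, sliceMap k (c k)

lemma integral_objectiveMap (κ : Kernel State (Fin n)) [IsMarkovKernel κ]
    (c : Fin n → C(State, ℝ)) :
    ∫ x, objectiveMap c x ∂(G.prior ⊗ₘ κ) = ∫ ω, ∑ k, share κ k ω * c k ω ∂G.prior := by
  rw [integral_compProd_eq_sum_share κ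
    ((objectiveMap c).continuous.integrable_of_hasCompactSupport
      (HasCompactSupport.of_compactSpace _))]
  simp [objectiveMap, sliceMap]

/-- The distance to the lower cutoff of `a_k`. -/
def surplusMap (k : Fin n) : C(State, ℝ) where
  toFun ω := (ω : ℝ) - G.cutoff k.castSucc
  continuous_toFun := by fun_prop

/-- The excess over the upper cutoff of `a_k`. -/
def excessMap (k : Fin n) : C(State, ℝ) where
  toFun ω := max ((ω : ℝ) - G.cutoff k.succ) 0
  continuous_toFun := by fun_prop

/-- Turns an almost-everywhere condition into an inequality for the integral of a continuous
function, which survives weak limits. -/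
lemma integral_excessMap_nonpos_iff (κ : Kernel State (Fin n)) [IsMarkovKernel κ] (k : Fin n) :
    ∫ ω, share κ k ω * G.excessMap k ω ∂G.prior ≤ 0 ↔
      ∀ᵐ ω : State ∂G.prior, G.cutoff k.succ < (ω : ℝ) → share κ k ω = 0 := by
  have h0 : ∀ ω, 0 ≤ share κ k ω * G.excessMap k ω := fun ω =>
    mul_nonneg (share_nonneg κ k ω) (le_max_right _ _)
  have hint : Integrable (fun ω => share κ k ω * G.excessMap k ω) G.prior := by
    refine integrable_share_mul κ k (G.excessMap k).continuous.measurable 1 fun ω => ?_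
    have h := abs_le.1 (G.abs_state_sub_cutoff_le k.succ ω)
    simp only [excessMap, ContinuousMap.coe_mk, abs_of_nonneg (le_max_right _ (0 : ℝ))]
    exact max_le h.2 zero_le_one
  rw [(integral_nonneg h0).ge_iff_eq', integral_eq_zero_iff_of_nonneg h0 hint]
  refine eventually_congr (Eventually.of_forall fun ω => ?_)
  simp only [Pi.zero_apply, mul_eq_zero, excessMap, ContinuousMap.coe_mk]
  constructor
  · rintro (h | h) hlt
    · exact h
    · have := le_max_left ((ω : ℝ) - G.cutoff k.succ) 0
      linarith
  · intro h
    by_cases hlt : G.cutoff k.succ < (ω : ℝ)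
    · exact Or.inl (h hlt)
    · exact Or.inr (max_eq_right (by linarith))

lemma isFeasible_iff (κ : Kernel State (Fin n)) [IsMarkovKernel κ] :
    G.IsFeasible κ ↔ (∀ k, 0 ≤ ∫ x, sliceMap k (G.surplusMap k) x ∂(G.prior ⊗ₘ κ)) ∧
      ∀ k, ∫ x, sliceMap k (G.excessMap k) x ∂(G.prior ⊗ₘ κ) ≤ 0 := by
  simp only [integral_sliceMap, integral_excessMap_nonpos_iff]
  exact ⟨fun h => ⟨h.1, h.2⟩, fun h => ⟨h.1, h.2⟩⟩

/-- The joint distributions of states and actions generated by feasible choices of actions. -/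
def feasibleLaws : Set (ProbabilityMeasure (State × Fin n)) :=
  {μ | μ.map (f := Prod.fst) measurable_fst.aemeasurable = ⟨G.prior, inferInstance⟩ ∧
    (∀ k, 0 ≤ ∫ x, sliceMap k (G.surplusMap k) x ∂(μ : Measure (State × Fin n))) ∧
    ∀ k, ∫ x, sliceMap k (G.excessMap k) x ∂(μ : Measure (State × Fin n)) ≤ 0}

/-- Probability measures on the compact space `State × Fin n` form a compact space, and each
defining condition is weakly closed. -/
lemma isCompact_feasibleLaws : IsCompact G.feasibleLaws := by
  refine IsClosed.isCompact ?_
  simp only [feasibleLaws, ofPred_and, ofPred_forall]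
  exact (isClosed_eq (ProbabilityMeasure.continuous_map continuous_fst) continuous_const).inter
    ((isClosed_iInter fun k => isClosed_le continuous_const
      (ProbabilityMeasure.continuous_integral_continuousMap _)).inter
    (isClosed_iInter fun k => isClosed_le
      (ProbabilityMeasure.continuous_integral_continuousMap _) continuous_const))

lemma mem_feasibleLaws (κ : Kernel State (Fin n)) [IsMarkovKernel κ] (h : G.IsFeasible κ) :
    (⟨G.prior ⊗ₘ κ, inferInstance⟩ : ProbabilityMeasure (State × Fin n)) ∈ G.feasibleLaws := by
  refine ⟨?_, (G.isFeasible_iff κ).1 h⟩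
  apply Subtype.ext
  exact Measure.fst_compProd G.prior κ

/-- Disintegration along the state leads back from joint laws to kernels. -/
lemma exists_kernel_of_mem_feasibleLaws {μ : ProbabilityMeasure (State × Fin n)}
    (hμ : μ ∈ G.feasibleLaws) :
    ∃ κ : Kernel State (Fin n), IsMarkovKernel κ ∧ G.IsFeasible κ ∧
      (μ : Measure (State × Fin n)) = G.prior ⊗ₘ κ := by
  have := G.neZero
  have hfst : (μ : Measure (State × Fin n)).fst = G.prior :=
    congrArg (fun ν : ProbabilityMeasure State => (ν : Measure State)) hμ.1
  have hdis := (μ : Measure (State × Fin n)).disintegrate (μ : Measure (State × Fin n)).condKernel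
  rw [hfst] at hdis
  refine ⟨_, inferInstance, (G.isFeasible_iff _).2 ?_, hdis.symm⟩
  rw [hdis]
  exact hμ.2

theorem exists_isLexOptimal (h : ∃ κ : Kernel State (Fin n), IsMarkovKernel κ ∧ G.IsFeasible κ) :
    ∃ κ : Kernel State (Fin n), IsMarkovKernel κ ∧ G.IsLexOptimal κ := by
  let V : C(State × Fin n, ℝ) := objectiveMap fun k => ContinuousMap.const _ (G.payoff k)
  let W : C(State × Fin n, ℝ) := objectiveMap fun k => ⟨fun ω => (k : ℝ) * (ω : ℝ) ^ 2, by fun_prop⟩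
  have hV : ∀ κ : Kernel State (Fin n), IsMarkovKernel κ →
      ∫ x, V x ∂(G.prior ⊗ₘ κ) = G.value κ := fun κ _ => G.integral_objectiveMap κ _
  have hW : ∀ κ : Kernel State (Fin n), IsMarkovKernel κ →
      ∫ x, W x ∂(G.prior ⊗ₘ κ) = G.spread κ := fun κ _ => G.integral_objectiveMap κ _
  have hVc := ProbabilityMeasure.continuous_integral_continuousMap V
  have hWc := ProbabilityMeasure.continuous_integral_continuousMap W
  obtain ⟨κ₀, _, h₀⟩ := h
  obtain ⟨μ₁, hμ₁, hmax₁⟩ := G.isCompact_feasibleLaws.exists_isMaxOn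
    ⟨_, G.mem_feasibleLaws κ₀ h₀⟩ hVc.continuousOn
  -- The maximizers of the value form a compact set, on which the spread is maximized in turn.
  obtain ⟨μ₂, ⟨hμ₂, hval⟩, hmax₂⟩ := (G.isCompact_feasibleLaws.inter_right
    (isClosed_eq hVc (continuous_const (y := ∫ x, V x ∂(μ₁ : Measure (State × Fin n)))))).exists_isMaxOn
    ⟨μ₁, hμ₁, rfl⟩ hWc.continuousOn
  obtain ⟨κ, hκ, hfeas, heq⟩ := G.exists_kernel_of_mem_feasibleLaws hμ₂
  have hval' : G.value κ = ∫ x, V x ∂(μ₁ : Measure (State × Fin n)) := by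
    rw [← hV κ hκ, ← heq]; exact hval
  refine ⟨κ, hκ, ⟨hfeas, fun κ' _ h' => ?_⟩, fun κ' hκ' h' hv => ?_⟩
  · rw [hval', ← hV κ' inferInstance]
    exact hmax₁ (G.mem_feasibleLaws κ' h')
  · rw [← hW κ hκ, ← heq, ← hW κ' hκ']
    refine hmax₂ ⟨G.mem_feasibleLaws κ' h', ?_⟩
    change ∫ x, V x ∂(G.prior ⊗ₘ κ') = _
    rw [hV κ' hκ', hv, hval']

end Game

/-! ### Integral estimates and balancing of masses -/

lemma integrable_of_continuous {μ : Measure State} [IsFiniteMeasure μ] {f : State → ℝ}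
    (hf : Continuous f) : Integrable f μ :=
  hf.integrable_of_hasCompactSupport (HasCompactSupport.of_compactSpace _)

lemma setIntegral_pos_of_forall_pos {μ : Measure State} [IsFiniteMeasure μ] {f : State → ℝ}
    (hf : Continuous f) {A : Set State} (hA : MeasurableSet A) (hpos : ∀ ω ∈ A, 0 < f ω)
    (hμ : μ A ≠ 0) : 0 < ∫ ω in A, f ω ∂μ := by
  rw [setIntegral_pos_iff_support_of_nonneg_ae _ (integrable_of_continuous hf).integrableOn]
  · refine pos_iff_ne_zero.2 ?_
    rwa [inter_eq_right.2 fun ω hω => Function.mem_support.2 (hpos ω hω).ne']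
  · exact (ae_restrict_iff' hA).2 (Eventually.of_forall fun ω hω => (hpos ω hω).le)

/-- A mass located between two others can be balanced against them, in total mass and mean. -/
lemma exists_balancing_weights {x0 y0 z0 x1 y1 z1 p q : ℝ} (hx0 : 0 < x0) (hy0 : 0 < y0)
    (hz0 : 0 < z0) (hx0' : x0 ≤ 1) (hy0' : y0 ≤ 1) (hz0' : z0 ≤ 1) (hx1 : 0 ≤ x1) (hy1 : 0 ≤ y1)
    (hz1 : 0 ≤ z1) (hx1' : x1 ≤ x0) (hz1' : z1 ≤ z0) (hpx : 0 ≤ x1 - p * x0)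
    (hqx : x1 - q * x0 ≤ 0) (hpy : y1 - p * y0 < 0) (hqz : 0 < z1 - q * z0) (hpq' : p ≤ q) :
    ∃ a b c : ℝ, 0 < a ∧ 0 < b ∧ 0 < c ∧ a ≤ 1 ∧ b ≤ 1 ∧ c ≤ 1 ∧
      c * x0 - a * y0 - b * z0 = 0 ∧ c * x1 - a * y1 - b * z1 = 0 := by
  -- By Cramer's rule, `(c, -a, -b)` is the cross product of the vectors of masses and of first
  -- moments, hence orthogonal to both. Positivity follows from the order of the three masses on the
  -- line, and the bound by one from all entries lying in the unit interval.
  let a := x0 * z1 - x1 * z0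
  let b := x1 * y0 - x0 * y1
  let c := y0 * z1 - y1 * z0
  have ha : 0 < a := by
    have e : a = x0 * (z1 - q * z0) + z0 * -(x1 - q * x0) := by ring
    have := mul_pos hx0 hqz
    have := mul_nonneg hz0.le (neg_nonneg.2 hqx)
    linarith
  have hb : 0 < b := by
    have e : b = y0 * (x1 - p * x0) + x0 * -(y1 - p * y0) := by ring
    have := mul_pos hx0 (neg_pos.2 hpy)
    have := mul_nonneg hy0.le hpx
    linarith
  have hc : 0 < c := by
    have e : c = y0 * (z1 - q * z0) + z0 * -(y1 - p * y0) + (q - p) * (y0 * z0) := by ring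
    have := mul_pos hy0 hqz
    have := mul_pos hz0 (neg_pos.2 hpy)
    have := mul_nonneg (sub_nonneg.2 hpq') (mul_pos hy0 hz0).le
    linarith
  have ha1 : a ≤ 1 := by
    have := mul_le_one₀ hx0' hz1 (hz1'.trans hz0')
    have := mul_nonneg hx1 hz0.le
    linarith
  have hb1 : b ≤ 1 := by
    have := mul_le_one₀ (hx1'.trans hx0') hy0.le hy0'
    have := mul_nonneg hx0.le hy1
    linarith
  have hc1 : c ≤ 1 := by
    have := mul_le_one₀ hy0' hz1 (hz1'.trans hz0')
    have := mul_nonneg hy1 hz0.le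
    linarith
  exact ⟨a, b, c, ha, hb, hc, ha1, hb1, hc1, by ring, by ring⟩

/-! ### Exchange arguments at an optimum -/

namespace Game

variable {n : ℕ} (G : Game n)

/-- The measure of states that choose action `a_k`. -/
def choosers (κ : Kernel State (Fin n)) (k : Fin n) : Measure State :=
  G.prior.withDensity fun ω => κ ω {k}

section Moments

lemma setIntegral_coe_nonneg {μ : Measure State} (A : Set State) : 0 ≤ ∫ ω in A, (ω : ℝ) ∂μ :=
  integral_nonneg fun ω => ω.2.1

variable {μ : Measure State} [IsFiniteMeasure μ]

lemma setIntegral_sub_const (A : Set State) (t : ℝ) :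
    ∫ ω in A, ((ω : ℝ) - t) ∂μ = ∫ ω in A, (ω : ℝ) ∂μ - t * ∫ _ω in A, (1 : ℝ) ∂μ := by
  rw [← integral_const_mul, ← integral_sub (integrable_of_continuous (by fun_prop))
    (integrable_of_continuous (by fun_prop))]
  simp

lemma setIntegral_sub_mul_sub (A : Set State) (p q : ℝ) :
    ∫ ω in A, ((ω : ℝ) - p) * ((ω : ℝ) - q) ∂μ =
      ∫ ω in A, (ω : ℝ) ^ 2 ∂μ - (p + q) * ∫ ω in A, (ω : ℝ) ∂μ +
        p * q * ∫ _ω in A, (1 : ℝ) ∂μ := by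
  rw [← integral_const_mul, ← integral_const_mul,
    ← integral_sub (integrable_of_continuous (by fun_prop))
    (integrable_of_continuous (by fun_prop)), ← integral_add
    (integrable_of_continuous (by fun_prop)) (integrable_of_continuous (by fun_prop))]
  congr 1 with ω
  ring

lemma setIntegral_coe_le (A : Set State) :
    ∫ ω in A, (ω : ℝ) ∂μ ≤ ∫ _ω in A, (1 : ℝ) ∂μ :=
  integral_mono (integrable_of_continuous (by fun_prop)) (integrable_const _) fun ω => ω.2.2

end Moments

section Choosers

variable (κ : Kernel State (Fin n)) [IsMarkovKernel κ]

lemma sum_choosers : ∑ k, G.choosers κ k = G.prior := by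
  ext s hs
  simp only [Measure.coe_finsetSum, Finset.sum_apply, choosers, withDensity_apply _ hs]
  rw [← lintegral_finsetSum _ fun k _ => κ.measurable_coe (measurableSet_singleton k)]
  simp [sum_measure_singleton]

lemma choosers_le_prior (k : Fin n) : G.choosers κ k ≤ G.prior := by
  conv_rhs => rw [← G.sum_choosers κ]
  exact Finset.single_le_sum (f := fun k => G.choosers κ k) (fun _ _ => Measure.zero_le _)
    (Finset.mem_univ k)

instance isFiniteMeasure_choosers (k : Fin n) : IsFiniteMeasure (G.choosers κ k) :=
  isFiniteMeasure_of_le _ (G.choosers_le_prior κ k)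

lemma setIntegral_choosers (k : Fin n) {A : Set State} (hA : MeasurableSet A) (f : State → ℝ) :
    ∫ ω in A, f ω ∂(G.choosers κ k) = ∫ ω in A, share κ k ω * f ω ∂G.prior := by
  rw [choosers, setIntegral_withDensity_eq_setIntegral_toReal_smul
    (κ.measurable_coe (measurableSet_singleton k))
    (Eventually.of_forall fun ω => measure_lt_top _ _) f hA]
  rfl

lemma integral_choosers (k : Fin n) (f : State → ℝ) :
    ∫ ω, f ω ∂(G.choosers κ k) = ∫ ω, share κ k ω * f ω ∂G.prior := by
  simpa using G.setIntegral_choosers κ k MeasurableSet.univ f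

lemma surplus_eq_integral_choosers (k : Fin n) :
    G.surplus κ k = ∫ ω : State, (ω : ℝ) - G.cutoff k.castSucc ∂(G.choosers κ k) :=
  (G.integral_choosers κ k _).symm

lemma integral_indicator_share_mul (k : Fin n) {A : Set State} (hA : MeasurableSet A)
    (f : State → ℝ) :
    ∫ ω, A.indicator (share κ k) ω * f ω ∂G.prior = ∫ ω in A, f ω ∂(G.choosers κ k) := by
  rw [G.setIntegral_choosers κ k hA, ← integral_indicator hA]
  congr 1 with ω
  by_cases h : ω ∈ A <;> simp [h]

lemma integrable_indicator_share_mul (k : Fin n) {A : Set State} (hA : MeasurableSet A)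
    {f : State → ℝ} (hf : Continuous f) :
    Integrable (fun ω => A.indicator (share κ k) ω * f ω) G.prior := by
  refine (Integrable.indicator (integrable_share κ k) hA).mul_of_top_left (MemLp.of_bound
    hf.aestronglyMeasurable (‖(⟨f, hf⟩ : C(State, ℝ))‖) (Eventually.of_forall fun ω => ?_))
  exact ContinuousMap.norm_coe_le_norm (⟨f, hf⟩ : C(State, ℝ)) ω

lemma choosers_real_univ_le_one (k : Fin n) : (G.choosers κ k).real univ ≤ 1 :=
  ENNReal.toReal_le_of_le_ofReal zero_le_one (by
    simpa using G.choosers_le_prior κ k univ)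

lemma setIntegral_one_choosers_le_one (k : Fin n) (A : Set State) :
    ∫ _ω in A, (1 : ℝ) ∂(G.choosers κ k) ≤ 1 := by
  rw [setIntegral_const, smul_eq_mul, mul_one]
  exact (measureReal_mono (subset_univ A)).trans (G.choosers_real_univ_le_one κ k)

lemma choosers_Ioi_cutoff (h : G.IsFeasible κ) (k : Fin n) :
    G.choosers κ k {ω : State | G.cutoff k.succ < (ω : ℝ)} = 0 := by
  rw [choosers, withDensity_apply _ (measurableSet_lt measurable_const measurable_subtype_coe),
    setLIntegral_eq_zero_iff (measurableSet_lt measurable_const measurable_subtype_coe)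
    (κ.measurable_coe (measurableSet_singleton k))]
  filter_upwards [h.share_eq_zero k] with ω hω hlt
  simpa [share, Measure.real, ENNReal.toReal_eq_zero_iff] using hω hlt

end Choosers

section Transfer

variable {κ : Kernel State (Fin n)} [IsMarkovKernel κ]

/-- Transferring the mass `g` from the choosers of `a_k` to the choosers of `a_i`. -/
theorem IsFeasible.exists_transfer (h : G.IsFeasible κ) {i k : Fin n} (hik : i < k)
    {g : State → ℝ} (hg : Measurable g) (hgi : ∀ ω, -share κ i ω ≤ g ω)
    (hgk : ∀ ω, g ω ≤ share κ k ω)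
    (hsupp : ∀ᵐ ω : State ∂G.prior, G.cutoff i.succ < (ω : ℝ) → g ω ≤ 0)
    (hi : 0 ≤ G.surplus κ i + ∫ ω : State, g ω * ((ω : ℝ) - G.cutoff i.castSucc) ∂G.prior)
    (hk : 0 ≤ G.surplus κ k - ∫ ω : State, g ω * ((ω : ℝ) - G.cutoff k.castSucc) ∂G.prior) :
    ∃ κ' : Kernel State (Fin n), IsMarkovKernel κ' ∧ G.IsFeasible κ' ∧
      G.value κ' = G.value κ - (G.payoff k - G.payoff i) * ∫ ω, g ω ∂G.prior ∧
      G.spread κ' = G.spread κ - ((k : ℝ) - i) * ∫ ω : State, g ω * (ω : ℝ) ^ 2 ∂G.prior := by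
  -- The mass `g` enters `a_i` with sign plus and `a_k` with sign minus. As `g` is signed, mass may
  -- flow in both directions.
  let d : Fin n → ℝ := fun l => (if l = i then 1 else 0) - (if l = k then 1 else 0)
  let α : Fin n → State → ℝ := fun l ω => share κ l ω + d l * g ω
  have hdi : d i = 1 := by simp [d, hik.ne]
  have hdk : d k = -1 := by simp [d, hik.ne']
  have hdl : ∀ l, l ≠ i → l ≠ k → d l = 0 := fun l h1 h2 => by simp [d, h1, h2]
  have hdsum : ∀ c : Fin n → ℝ, ∑ l, d l * c l = c i - c k := fun c => by
    simp [d, sub_mul, Finset.sum_sub_distrib]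
  have hα : ∀ l, Measurable (α l) := fun l => (measurable_share κ l).add (hg.const_mul _)
  have h0 : ∀ l ω, 0 ≤ α l ω := by
    intro l ω
    by_cases h1 : l = i
    · subst h1; simp only [α, hdi]; linarith [hgi ω]
    by_cases h2 : l = k
    · subst h2; simp only [α, hdk]; linarith [hgk ω]
    simp only [α, hdl l h1 h2, zero_mul, add_zero]
    exact share_nonneg κ l ω
  have h1 : ∀ ω, ∑ l, α l ω = 1 := by
    intro ω
    simp only [α, Finset.sum_add_distrib, sum_share, hdsum fun _ => g ω, sub_self, add_zero]
  have hshare : ∀ l ω, share (kernelOfShares α hα) l ω = share κ l ω + d l * g ω :=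
    fun l ω => share_kernelOfShares hα h0 l ω
  have hgb : ∀ ω, |g ω| ≤ 1 := fun ω => abs_le.2
    ⟨by linarith [hgi ω, share_le_one κ i ω], (hgk ω).trans (share_le_one κ k ω)⟩
  have hgint : ∀ f : State → ℝ, Continuous f → Integrable (fun ω => g ω * f ω) G.prior := by
    intro f hf
    exact (integrable_of_continuous hf).bdd_mul hg.aestronglyMeasurable
      (Eventually.of_forall hgb)
  have hsint : ∀ (l : Fin n) (f : State → ℝ), Continuous f →
      Integrable (fun ω => share κ l ω * f ω) G.prior := fun l f hf =>
    (integrable_of_continuous hf).bdd_mul (measurable_share κ l).aestronglyMeasurable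
      (Eventually.of_forall fun ω => by
        rw [Real.norm_of_nonneg (share_nonneg κ l ω)]; exact share_le_one κ l ω)
  have hsum : ∀ c : Fin n → ℝ, ∀ f : State → ℝ, Continuous f →
      ∫ ω, ∑ l, share (kernelOfShares α hα) l ω * (c l * f ω) ∂G.prior =
      ∫ ω, ∑ l, share κ l ω * (c l * f ω) ∂G.prior - (c k - c i) * ∫ ω, g ω * f ω ∂G.prior := by
    intro c f hf
    rw [← integral_const_mul, ← integral_sub _ ((hgint f hf).const_mul _)]
    · congr 1 with ω
      simp only [hshare, add_mul, Finset.sum_add_distrib]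
      have := hdsum fun l => g ω * (c l * f ω)
      simp only [← mul_assoc] at this ⊢
      rw [this]; ring
    · exact integrable_finsetSum _ fun l _ => hsint l _ (hf.const_mul _)
  have hsurplus : ∀ l, G.surplus (kernelOfShares α hα) l =
      G.surplus κ l + d l * ∫ ω : State, g ω * ((ω : ℝ) - G.cutoff l.castSucc) ∂G.prior := by
    intro l
    have hc : Continuous fun ω : State => (ω : ℝ) - G.cutoff l.castSucc := by fun_prop
    rw [surplus, surplus, ← integral_const_mul,
      ← integral_add (hsint l _ hc) ((hgint _ hc).const_mul _)]
    congr 1 with ω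
    rw [hshare]; ring
  refine ⟨kernelOfShares α hα, isMarkovKernel_kernelOfShares hα h0 h1, ⟨fun l => ?_, fun l => ?_⟩,
    ?_, ?_⟩
  · rw [hsurplus]
    by_cases h1 : l = i
    · subst h1; rw [hdi, one_mul]; exact hi
    by_cases h2 : l = k
    · subst h2; rw [hdk]; linarith
    rw [hdl l h1 h2, zero_mul, add_zero]
    exact h.surplus_nonneg l
  -- Above the upper cutoff of `a_i` the share of `a_i` vanishes, which forces `g ≥ 0`, while
  -- `hsupp` gives `g ≤ 0`. So nothing is transferred there, nor above the larger upper cutoff of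
  -- `a_k`.
  · filter_upwards [h.share_eq_zero l, h.share_eq_zero i, hsupp] with ω hl hi hs hlt
    rw [hshare, hl hlt]
    by_cases h1 : l = i
    · subst h1
      have := hgi ω
      rw [hl hlt] at this
      rw [hdi]; linarith [hs hlt]
    by_cases h2 : l = k
    · subst h2
      have hlt' : G.cutoff i.succ < (ω : ℝ) :=
        (G.cutoff_mono (Fin.succ_le_succ_iff.2 hik.le)).trans_lt hlt
      have := hgi ω
      rw [hi hlt'] at this
      rw [hdk]; linarith [hs hlt']
    rw [hdl l h1 h2]; ring
  · simpa [value] using hsum G.payoff (fun _ => 1) continuous_const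
  · simpa [spread] using hsum (fun l => (l : ℝ)) (fun ω => (ω : ℝ) ^ 2) (by fun_prop)

/-- If a lower action is chosen, then the surplus of an action vanishes at an optimum. -/
theorem IsValueMaximal.surplus_eq_zero (h : G.IsValueMaximal κ) {i k : Fin n} (hik : i < k)
    (hi : G.choosers κ i ≠ 0) : G.surplus κ k = 0 := by
  by_contra hne
  have hpos : 0 < G.surplus κ k := lt_of_le_of_ne (h.1.surplus_nonneg k) (Ne.symm hne)
  -- A fraction `ε` of the choosers of `a_i` is promoted to `a_k`. Their mass and their distance to
  -- the cutoff are at most one, so this costs at most `ε` of the surplus of `a_k`.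
  set ε := min 1 (G.surplus κ k) with hε
  have hε0 : 0 < ε := lt_min one_pos hpos
  have hε1 : ε ≤ 1 := min_le_left _ _
  have hint : ∀ f : State → ℝ, ∫ ω, -ε * share κ i ω * f ω ∂G.prior =
      -ε * ∫ ω, f ω ∂(G.choosers κ i) := by
    intro f
    rw [G.integral_choosers, ← integral_const_mul]
    simp only [mul_assoc]
  have hlow : -1 ≤ ∫ ω : State, (ω : ℝ) - G.cutoff k.castSucc ∂(G.choosers κ i) := by
    have hle : ∫ _ω : State, (-1 : ℝ) ∂(G.choosers κ i) ≤
        ∫ ω : State, (ω : ℝ) - G.cutoff k.castSucc ∂(G.choosers κ i) :=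
      integral_mono (integrable_const _) (integrable_of_continuous (by fun_prop)) fun ω =>
        (abs_le.1 (G.abs_state_sub_cutoff_le k.castSucc ω)).1
    rw [integral_const, smul_eq_mul] at hle
    linarith [G.choosers_real_univ_le_one κ i]
  obtain ⟨κ', hκ', hfeas, hval, -⟩ := h.1.exists_transfer G hik
    (g := fun ω => -ε * share κ i ω) ((measurable_share κ i).const_mul _)
    (fun ω => by nlinarith [share_nonneg κ i ω])
    (fun ω => by nlinarith [share_nonneg κ i ω, share_nonneg κ k ω])
    (Eventually.of_forall fun ω _ => by nlinarith [share_nonneg κ i ω])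
    (by
      rw [hint, ← G.surplus_eq_integral_choosers]
      nlinarith [h.1.surplus_nonneg i])
    (by
      rw [hint]
      nlinarith [min_le_right 1 (G.surplus κ k)])
  have hmass := hint fun _ => 1
  simp only [mul_one, integral_const, smul_eq_mul] at hmass
  have hreal : 0 < (G.choosers κ i).real univ := by
    exact ENNReal.toReal_pos (by simpa using hi) (measure_ne_top _ _)
  rw [hmass] at hval
  have hpay := G.payoff_strictMono hik
  have := h.2 κ' hκ' hfeas
  nlinarith [mul_pos (mul_pos hε0 hreal) (sub_pos.2 hpay)]

/-- At an optimum, no state that chooses a higher action lies between states that choose a lower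
action. -/
theorem IsLexOptimal.choosers_Icc (h : G.IsLexOptimal κ) {i k : Fin n} (hik : i < k)
    {p q : State} (hp : G.choosers κ i (Iio p) ≠ 0) (hq : G.choosers κ i (Ioi q) ≠ 0) (hpq : p ≤ q) :
    G.choosers κ k (Icc p q) = 0 := by
  by_contra hX
  have hfeas := h.1.1
  -- Some choosers of `a_i` lie above `q`, so all of `[p, q]` is below the upper cutoff of `a_i` and
  -- states there may be moved down to `a_i`.
  have hqγ : (q : ℝ) < G.cutoff i.succ := by
    by_contra hle
    push Not at hle
    refine hq (measure_mono_null (fun ω hω => ?_) (G.choosers_Ioi_cutoff κ hfeas i))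
    exact hle.trans_lt (show (q : ℝ) < ω from hω)
  set μ := G.choosers κ i
  set ν := G.choosers κ k
  set x0 := ∫ _ω in Icc p q, (1 : ℝ) ∂ν
  set y0 := ∫ _ω in Iio p, (1 : ℝ) ∂μ
  set z0 := ∫ _ω in Ioi q, (1 : ℝ) ∂μ
  set x1 := ∫ ω in Icc p q, (ω : ℝ) ∂ν
  set y1 := ∫ ω in Iio p, (ω : ℝ) ∂μ
  set z1 := ∫ ω in Ioi q, (ω : ℝ) ∂μ
  have hx0 : 0 < x0 :=
    setIntegral_pos_of_forall_pos continuous_const measurableSet_Icc (fun _ _ => one_pos) hX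
  have hy0 : 0 < y0 :=
    setIntegral_pos_of_forall_pos continuous_const measurableSet_Iio (fun _ _ => one_pos) hp
  have hz0 : 0 < z0 :=
    setIntegral_pos_of_forall_pos continuous_const measurableSet_Ioi (fun _ _ => one_pos) hq
  have hx0' : x0 ≤ 1 := G.setIntegral_one_choosers_le_one κ k _
  have hy0' : y0 ≤ 1 := G.setIntegral_one_choosers_le_one κ i _
  have hz0' : z0 ≤ 1 := G.setIntegral_one_choosers_le_one κ i _
  have hx1 : 0 ≤ x1 := setIntegral_coe_nonneg _
  have hy1 : 0 ≤ y1 := setIntegral_coe_nonneg _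
  have hz1 : 0 ≤ z1 := setIntegral_coe_nonneg _
  have hx1' : x1 ≤ x0 := setIntegral_coe_le _
  have hz1' : z1 ≤ z0 := setIntegral_coe_le _
  have hpx : 0 ≤ x1 - p * x0 := by
    rw [← setIntegral_sub_const]
    exact setIntegral_nonneg measurableSet_Icc fun ω hω => sub_nonneg.2 hω.1
  have hqx : x1 - q * x0 ≤ 0 := by
    rw [← setIntegral_sub_const]
    exact setIntegral_nonpos measurableSet_Icc fun ω hω => sub_nonpos.2 hω.2
  have hpy : y1 - p * y0 < 0 := by
    rw [← setIntegral_sub_const, ← neg_pos, ← integral_neg]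
    exact setIntegral_pos_of_forall_pos (by fun_prop) measurableSet_Iio
      (fun ω (hω : ω < p) => by have : (ω : ℝ) < p := hω; linarith) hp
  have hqz : 0 < z1 - q * z0 := by
    rw [← setIntegral_sub_const]
    exact setIntegral_pos_of_forall_pos (by fun_prop) measurableSet_Ioi
      (fun ω hω => sub_pos.2 hω) hq
  obtain ⟨a, b, c, ha, hb, hc, ha1, hb1, hc1, hm0, hm1⟩ := exists_balancing_weights hx0 hy0 hz0
    hx0' hy0' hz0' hx1 hy1 hz1 hx1' hz1' hpx hqx hpy hqz hpq
  -- Choosers of `a_k` in the middle are exchanged for choosers of `a_i` on both sides, in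
  -- proportions that preserve mass and mean.
  let g : State → ℝ := fun ω => c * (Icc p q).indicator (share κ k) ω -
    a * (Iio p).indicator (share κ i) ω - b * (Ioi q).indicator (share κ i) ω
  have hg : Measurable g :=
    ((((measurable_share κ k).indicator measurableSet_Icc).const_mul c).sub
    (((measurable_share κ i).indicator measurableSet_Iio).const_mul a)).sub
    (((measurable_share κ i).indicator measurableSet_Ioi).const_mul b)
  have hgf : ∀ f : State → ℝ, Continuous f → ∫ ω, g ω * f ω ∂G.prior =
      c * ∫ ω in Icc p q, f ω ∂ν - a * ∫ ω in Iio p, f ω ∂μ - b * ∫ ω in Ioi q, f ω ∂μ := by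
    intro f hf
    rw [← G.integral_indicator_share_mul κ k measurableSet_Icc,
      ← G.integral_indicator_share_mul κ i measurableSet_Iio,
      ← G.integral_indicator_share_mul κ i measurableSet_Ioi,
      ← integral_const_mul, ← integral_const_mul, ← integral_const_mul,
      ← integral_sub, ← integral_sub]
    · congr 1 with ω
      simp only [g]; ring
    · exact ((G.integrable_indicator_share_mul κ k measurableSet_Icc hf).const_mul c).sub
        ((G.integrable_indicator_share_mul κ i measurableSet_Iio hf).const_mul a)
    · exact (G.integrable_indicator_share_mul κ i measurableSet_Ioi hf).const_mul b
    · exact (G.integrable_indicator_share_mul κ k measurableSet_Icc hf).const_mul c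
    · exact (G.integrable_indicator_share_mul κ i measurableSet_Iio hf).const_mul a
  have hglin : ∀ t : ℝ, ∫ ω : State, g ω * ((ω : ℝ) - t) ∂G.prior = 0 := by
    intro t
    rw [hgf _ (by fun_prop), setIntegral_sub_const, setIntegral_sub_const, setIntegral_sub_const]
    linear_combination hm1 - t * hm0
  have hgone : ∫ ω, g ω ∂G.prior = 0 := by
    have := hgf (fun _ => 1) continuous_const
    simp only [mul_one] at this
    rw [this]; exact hm0
  -- `g` annihilates affine functions, so the square may be replaced by `(ω - p) * (ω - q)`, which
  -- is nonpositive in the middle and positive outside.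
  have hgsq : ∫ ω : State, g ω * (ω : ℝ) ^ 2 ∂G.prior < 0 := by
    have e : ∫ ω : State, g ω * (ω : ℝ) ^ 2 ∂G.prior =
        c * ∫ ω in Icc p q, ((ω : ℝ) - p) * ((ω : ℝ) - q) ∂ν -
        a * ∫ ω in Iio p, ((ω : ℝ) - p) * ((ω : ℝ) - q) ∂μ -
        b * ∫ ω in Ioi q, ((ω : ℝ) - p) * ((ω : ℝ) - q) ∂μ := by
      rw [hgf _ (by fun_prop), setIntegral_sub_mul_sub, setIntegral_sub_mul_sub,
        setIntegral_sub_mul_sub]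
      linear_combination (p + q : ℝ) * hm1 - (p * q : ℝ) * hm0
    have hX2 : ∫ ω in Icc p q, ((ω : ℝ) - p) * ((ω : ℝ) - q) ∂ν ≤ 0 :=
      setIntegral_nonpos measurableSet_Icc fun ω hω =>
        mul_nonpos_of_nonneg_of_nonpos (sub_nonneg.2 hω.1) (sub_nonpos.2 hω.2)
    have hY2 : 0 < ∫ ω in Iio p, ((ω : ℝ) - p) * ((ω : ℝ) - q) ∂μ :=
      setIntegral_pos_of_forall_pos (by fun_prop) measurableSet_Iio (fun ω hω =>
        mul_pos_of_neg_of_neg (sub_neg.2 hω) (sub_neg.2 (hω.trans_le hpq))) hp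
    have hZ2 : 0 ≤ ∫ ω in Ioi q, ((ω : ℝ) - p) * ((ω : ℝ) - q) ∂μ :=
      setIntegral_nonneg measurableSet_Ioi fun ω hω =>
        mul_nonneg (sub_nonneg.2 (hpq.trans (le_of_lt hω))) (sub_nonneg.2 (le_of_lt hω))
    rw [e]
    have := mul_nonpos_of_nonneg_of_nonpos hc.le hX2
    have := mul_pos ha hY2
    have := mul_nonneg hb.le hZ2
    linarith
  have hgcases : ∀ ω, (ω ∈ Icc p q ∧ g ω = c * share κ k ω) ∨ (ω < p ∧ g ω = -a * share κ i ω) ∨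
      (q < ω ∧ g ω = -b * share κ i ω) := by
    intro ω
    rcases lt_or_ge ω p with h1 | h1
    · have h2 : ¬ p ≤ ω := not_le.2 h1
      have h3 : ¬ q < ω := not_lt.2 (h1.le.trans hpq)
      right; left; refine ⟨h1, ?_⟩
      simp [g, h1, h2, h3]
    rcases lt_or_ge q ω with h3 | h3
    · right; right; refine ⟨h3, ?_⟩
      simp [g, h3, not_le.2 h3, not_lt.2 h1]
    · left; refine ⟨⟨h1, h3⟩, ?_⟩
      simp [g, h1, h3, not_lt.2 h3, not_lt.2 h1]
  obtain ⟨κ', hκ', hfeas', hval, hspr⟩ := hfeas.exists_transfer G hik hg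
    (fun ω => by
      have hi := share_nonneg κ i ω
      rcases hgcases ω with ⟨_, e⟩ | ⟨_, e⟩ | ⟨_, e⟩ <;> rw [e]
      · exact (neg_nonpos.2 hi).trans (mul_nonneg hc.le (share_nonneg κ k ω))
      · rw [neg_mul]; exact neg_le_neg (mul_le_of_le_one_left hi ha1)
      · rw [neg_mul]; exact neg_le_neg (mul_le_of_le_one_left hi hb1))
    (fun ω => by
      have hi := share_nonneg κ i ω
      have hk := share_nonneg κ k ω
      rcases hgcases ω with ⟨_, e⟩ | ⟨_, e⟩ | ⟨_, e⟩ <;> rw [e]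
      · exact mul_le_of_le_one_left hk hc1
      · rw [neg_mul]; exact (neg_nonpos.2 (mul_nonneg ha.le hi)).trans hk
      · rw [neg_mul]; exact (neg_nonpos.2 (mul_nonneg hb.le hi)).trans hk)
    (Eventually.of_forall fun ω hω => by
      have hi := share_nonneg κ i ω
      rcases hgcases ω with ⟨hmem, e⟩ | ⟨_, e⟩ | ⟨_, e⟩
      · exact absurd (hω.trans_le (show (ω : ℝ) ≤ q from hmem.2)) hqγ.not_gt
      · rw [e, neg_mul]; exact neg_nonpos.2 (mul_nonneg ha.le hi)
      · rw [e, neg_mul]; exact neg_nonpos.2 (mul_nonneg hb.le hi))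
    (by rw [hglin, add_zero]; exact hfeas.surplus_nonneg i)
    (by rw [hglin, sub_zero]; exact hfeas.surplus_nonneg k)
  rw [hgone, mul_zero, sub_zero] at hval
  have hle := h.2 κ' hκ' hfeas' hval
  rw [hspr] at hle
  have hik' : (i : ℝ) < k := by exact_mod_cast hik
  exact absurd hle (not_le.2 (lt_sub_iff_add_lt.2 (add_lt_of_neg_right _
    (mul_neg_of_pos_of_neg (sub_pos.2 hik') hgsq))))

/-- At an optimum, no state that chooses a higher action lies below a state that chooses the lowest
action. -/
theorem IsValueMaximal.choosers_Iic (h : G.IsValueMaximal κ) {i k : Fin n} (hi : (i : ℕ) = 0)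
    (hik : i < k) {p : State} (hp : G.choosers κ i (Ioi p) ≠ 0) :
    G.choosers κ k (Iic p) = 0 := by
  by_contra hX
  have hfeas := h.1
  have hpγ : (p : ℝ) < G.cutoff i.succ := by
    by_contra hle
    push Not at hle
    refine hp (measure_mono_null (fun ω hω => ?_) (G.choosers_Ioi_cutoff κ hfeas i))
    exact hle.trans_lt (show (p : ℝ) < ω from hω)
  have hγ0 : G.cutoff i.castSucc = 0 := by
    rw [← G.cutoff_zero]; congr 1; exact Fin.ext hi
  set μ := G.choosers κ i
  set ν := G.choosers κ k
  set x0 := ∫ _ω in Iic p, (1 : ℝ) ∂ν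
  set y0 := ∫ _ω in Ioi p, (1 : ℝ) ∂μ
  set x1 := ∫ ω in Iic p, (ω : ℝ) ∂ν
  set y1 := ∫ ω in Ioi p, (ω : ℝ) ∂μ
  have hx0 : 0 < x0 :=
    setIntegral_pos_of_forall_pos continuous_const measurableSet_Iic (fun _ _ => one_pos) hX
  have hy0 : 0 < y0 :=
    setIntegral_pos_of_forall_pos continuous_const measurableSet_Ioi (fun _ _ => one_pos) hp
  have hx0' : x0 ≤ 1 := G.setIntegral_one_choosers_le_one κ k _
  have hy0' : y0 ≤ 1 := G.setIntegral_one_choosers_le_one κ i _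
  have hx1 : 0 ≤ x1 := setIntegral_coe_nonneg _
  have hy1 : 0 ≤ y1 := setIntegral_coe_nonneg _
  have hx1' : x1 ≤ x0 := setIntegral_coe_le _
  have hy1' : y1 ≤ y0 := setIntegral_coe_le _
  have hpx : x1 - p * x0 ≤ 0 := by
    rw [← setIntegral_sub_const]
    exact setIntegral_nonpos measurableSet_Iic fun ω hω => sub_nonpos.2 hω
  have hpy : 0 < y1 - p * y0 := by
    rw [← setIntegral_sub_const]
    exact setIntegral_pos_of_forall_pos (by fun_prop) measurableSet_Ioi
      (fun ω hω => sub_pos.2 hω) hp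
  set t := x0 * y1 - y0 * x1
  have ht : 0 < t := by
    have e : t = x0 * (y1 - p * y0) + y0 * -(x1 - p * x0) := by ring
    have := mul_pos hx0 hpy
    have := mul_nonneg hy0.le (neg_nonneg.2 hpx)
    linarith
  have ht1 : t ≤ 1 := by
    have := mul_le_one₀ hx0' hy1 (hy1'.trans hy0')
    have := mul_nonneg hy0.le hx1
    linarith
  -- With `c = y0` the swap would preserve mass. The factor `1 - t` moves less mass down, so that
  -- `a_k` gains mass on balance; the moment gain `t` pays for it. The surplus of `a_i` is no
  -- obstacle, its lower cutoff being zero.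
  set c := (1 - t) * y0
  have hc : 0 ≤ c := mul_nonneg (sub_nonneg.2 ht1) hy0.le
  have hc1 : c ≤ 1 := mul_le_one₀ (by linarith) hy0.le hy0'
  let g : State → ℝ := fun ω => c * (Iic p).indicator (share κ k) ω -
    x0 * (Ioi p).indicator (share κ i) ω
  have hg : Measurable g :=
    (((measurable_share κ k).indicator measurableSet_Iic).const_mul c).sub
    (((measurable_share κ i).indicator measurableSet_Ioi).const_mul x0)
  have hgf : ∀ f : State → ℝ, Continuous f → ∫ ω, g ω * f ω ∂G.prior =
      c * ∫ ω in Iic p, f ω ∂ν - x0 * ∫ ω in Ioi p, f ω ∂μ := by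
    intro f hf
    rw [← G.integral_indicator_share_mul κ k measurableSet_Iic,
      ← G.integral_indicator_share_mul κ i measurableSet_Ioi,
      ← integral_const_mul, ← integral_const_mul, ← integral_sub]
    · congr 1 with ω
      simp only [g]; ring
    · exact (G.integrable_indicator_share_mul κ k measurableSet_Iic hf).const_mul c
    · exact (G.integrable_indicator_share_mul κ i measurableSet_Ioi hf).const_mul x0
  have hgcases : ∀ ω, (ω ≤ p ∧ g ω = c * share κ k ω) ∨ (p < ω ∧ g ω = -x0 * share κ i ω) := by
    intro ω
    rcases le_or_gt ω p with h1 | h1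
    · left; refine ⟨h1, ?_⟩
      simp [g, h1, not_lt.2 h1]
    · right; refine ⟨h1, ?_⟩
      simp [g, h1, not_le.2 h1]
  obtain ⟨κ', hκ', hfeas', hval, -⟩ := hfeas.exists_transfer G hik hg
    (fun ω => by
      have := share_nonneg κ i ω
      have := share_nonneg κ k ω
      rcases hgcases ω with ⟨_, e⟩ | ⟨_, e⟩ <;> rw [e] <;> nlinarith)
    (fun ω => by
      have := share_nonneg κ i ω
      have := share_nonneg κ k ω
      rcases hgcases ω with ⟨_, e⟩ | ⟨_, e⟩ <;> rw [e] <;> nlinarith)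
    (Eventually.of_forall fun ω hω => by
      have := share_nonneg κ i ω
      rcases hgcases ω with ⟨hmem, e⟩ | ⟨_, e⟩
      · have : (ω : ℝ) ≤ p := hmem
        linarith
      · rw [e]; nlinarith)
    (by
      have hs : y1 ≤ G.surplus κ i := by
        rw [surplus_eq_integral_choosers, hγ0]
        simp only [sub_zero]
        exact setIntegral_le_integral (integrable_of_continuous (by fun_prop))
          (Eventually.of_forall fun ω => ω.2.1)
      rw [hγ0, hgf _ (by fun_prop)]
      simp only [sub_zero]
      change 0 ≤ G.surplus κ i + (c * x1 - x0 * y1)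
      have := mul_nonneg hc hx1
      have := mul_le_of_le_one_left hy1 hx0'
      linarith)
    (by
      have hγ := G.cutoff_nonneg k.castSucc
      have hγ' := G.cutoff_le_one k.castSucc
      rw [hgf _ (by fun_prop), setIntegral_sub_const, setIntegral_sub_const]
      change 0 ≤ G.surplus κ k - (c * (x1 - _ * x0) - x0 * (y1 - _ * y0))
      have e : c * (x1 - G.cutoff k.castSucc * x0) - x0 * (y1 - G.cutoff k.castSucc * y0) =
          -(t * (1 + y0 * x1 - G.cutoff k.castSucc * (x0 * y0))) := by ring
      rw [e]
      have h1 := mul_le_one₀ hγ' (mul_pos hx0 hy0).le (mul_le_one₀ hx0' hy0.le hy0')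
      have h2 := mul_nonneg hy0.le hx1
      have := mul_nonneg ht.le (show
        0 ≤ 1 + y0 * x1 - G.cutoff k.castSucc * (x0 * y0) by linarith)
      linarith [h.1.surplus_nonneg k])
  have hgone : ∫ ω, g ω ∂G.prior = -(t * (x0 * y0)) := by
    have := hgf (fun _ => 1) continuous_const
    simp only [mul_one] at this
    rw [this]
    change c * x0 - x0 * y0 = _
    ring
  rw [hgone] at hval
  have hle := h.2 κ' hκ' hfeas'
  nlinarith [mul_pos (sub_pos.2 (G.payoff_strictMono hik)) (mul_pos ht (mul_pos hx0 hy0))]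

end Transfer

end Game

/-! ### Convex hulls and unions of intervals in the state space -/

section Hull

lemma mem_hull_iff {S : Set State} {x : State} : x ∈ hull S ↔ ∃ y ∈ S, ∃ z ∈ S, y ≤ x ∧ x ≤ z := by
  constructor
  · intro hx
    have hconv : Convex ℝ {t : ℝ | ∃ y ∈ S, ∃ z ∈ S, (y : ℝ) ≤ t ∧ t ≤ z} := by
      refine OrdConnected.convex ⟨?_⟩
      rintro a ⟨y, hy, _, _, hya, _⟩ b ⟨_, _, z, hz, _, hbz⟩ t ht
      exact ⟨y, hy, z, hz, hya.trans ht.1, ht.2.trans hbz⟩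
    have hsub : (fun y : State => (y : ℝ)) '' S ⊆
        {t : ℝ | ∃ y ∈ S, ∃ z ∈ S, (y : ℝ) ≤ t ∧ t ≤ z} := by
      rintro _ ⟨y, hy, rfl⟩
      exact ⟨y, hy, y, hy, le_rfl, le_rfl⟩
    exact convexHull_min hsub hconv hx
  · rintro ⟨y, hy, z, hz, hyx, hxz⟩
    exact (convex_convexHull ℝ _).ordConnected.out
      (subset_convexHull ℝ _ (mem_image_of_mem (fun y : State => (y : ℝ)) hy))
      (subset_convexHull ℝ _ (mem_image_of_mem (fun y : State => (y : ℝ)) hz)) ⟨hyx, hxz⟩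

lemma subset_hull (S : Set State) : S ⊆ hull S := fun x hx =>
  mem_hull_iff.2 ⟨x, hx, x, hx, le_rfl, le_rfl⟩

lemma hull_empty : hull ∅ = ∅ := by
  ext x; simp [mem_hull_iff]

lemma ordConnected_hull (S : Set State) : (hull S).OrdConnected := by
  refine ⟨fun a ha b hb t ht => ?_⟩
  obtain ⟨y, hy, _, _, hya, _⟩ := mem_hull_iff.1 ha
  obtain ⟨_, _, z, hz, _, hbz⟩ := mem_hull_iff.1 hb
  exact mem_hull_iff.2 ⟨y, hy, z, hz, hya.trans ht.1, ht.2.trans hbz⟩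

lemma isClosed_hull {S : Set State} (hS : IsClosed S) : IsClosed (hull S) := by
  rcases S.eq_empty_or_nonempty with rfl | hne
  · rw [hull_empty]; exact isClosed_empty
  obtain ⟨l, hl⟩ := hS.isCompact.exists_isLeast hne
  obtain ⟨r, hr⟩ := hS.isCompact.exists_isGreatest hne
  have : hull S = Icc l r := by
    ext x
    rw [mem_hull_iff]
    constructor
    · rintro ⟨y, hy, z, hz, hyx, hxz⟩
      exact ⟨(hl.2 hy).trans hyx, hxz.trans (hr.2 hz)⟩
    · exact fun hx => ⟨l, hl.1, r, hr.1, hx.1, hx.2⟩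
  rw [this]
  exact isClosed_Icc

end Hull

section Intervals

lemma IsUnionOfDisjointIntervals.mono {M N : ℕ} {S : Set State}
    (h : IsUnionOfDisjointIntervals M S) (hMN : M ≤ N) : IsUnionOfDisjointIntervals N S :=
  let ⟨m, hm, J⟩ := h
  ⟨m, hm.trans hMN, J⟩

/-- A set whose points are connected to one of `N` given points is a union of `N` intervals. -/
lemma isUnionOfDisjointIntervals_of_ordConnectedComponent {N : ℕ} {S : Set State}
    (x : Fin N → State) (h : ∀ y ∈ S, ∃ s, y ∈ S.ordConnectedComponent (x s)) :
    IsUnionOfDisjointIntervals N S := by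
  classical
  -- Collecting the components as a set removes duplicates, and distinct order-connected components
  -- are disjoint.
  let P : Finset (Set State) :=
    (Finset.univ.image fun s => S.ordConnectedComponent (x s)).filter Set.Nonempty
  have hP : ∀ C ∈ P, ∃ s, S.ordConnectedComponent (x s) = C ∧ C.Nonempty := by
    intro C hC
    simpa [P] using hC
  refine ⟨P.card, ?_, fun a => (P.equivFin.symm a : Set State), fun a => ?_, fun a b hab => ?_, ?_⟩
  · refine (Finset.card_filter_le _ _).trans (Finset.card_image_le.trans ?_)
    simp
  · obtain ⟨s, hs, hne⟩ := hP _ (P.equivFin.symm a).2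
    refine ⟨hne, ?_⟩
    dsimp only
    rw [← hs]
    infer_instance
  · obtain ⟨s, hs, -⟩ := hP _ (P.equivFin.symm a).2
    obtain ⟨t, ht, -⟩ := hP _ (P.equivFin.symm b).2
    have hne : (P.equivFin.symm a : Set State) ≠ P.equivFin.symm b := fun h =>
      hab (P.equivFin.symm.injective (Subtype.ext h))
    rw [disjoint_left]
    intro y hya hyb
    dsimp only at hya hyb
    rw [← hs] at hya
    rw [← ht] at hyb
    refine hne ?_
    rw [← hs, ← ht, ordConnectedComponent_eq hya, ordConnectedComponent_eq hyb]
  · ext y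
    simp only [mem_iUnion]
    constructor
    · intro hy
      obtain ⟨s, hs⟩ := h y hy
      have hmem : S.ordConnectedComponent (x s) ∈ P := by
        simp only [P, Finset.mem_filter, Finset.mem_image, Finset.mem_univ, true_and]
        exact ⟨⟨s, rfl⟩, ⟨y, hs⟩⟩
      exact ⟨P.equivFin ⟨_, hmem⟩, by simpa using hs⟩
    · rintro ⟨a, ha⟩
      obtain ⟨s, hs, -⟩ := hP _ (P.equivFin.symm a).2
      rw [← hs] at ha
      exact ordConnectedComponent_subset ha

end Intervals

/-! ### Nested covers: laminarity and the number of intervals -/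

/-- A closed cover by sets without isolated points such that no point of a later set lies strictly
between points of an earlier set. -/
structure IsNestedCover {n : ℕ} (B : Fin n → Set State) : Prop where
  isClosed : ∀ k, IsClosed (B k)
  covers : ⋃ k, B k = univ
  not_between : ∀ i k, i < k → ∀ x ∈ B k, ∀ y ∈ B i, ∀ z ∈ B i, y < x → ¬ x < z
  subset_closure_diff : ∀ k (E : Set State), E.Finite → B k ⊆ closure (B k \ E)

namespace IsNestedCover

variable {n : ℕ} {B : Fin n → Set State} (h : IsNestedCover B)

/-- The endpoints of the sets of a family. -/
def endpoints (B : Fin n → Set State) : Set State :=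
  ⋃ i, ({x | IsLeast (B i) x} ∪ {x | IsGreatest (B i) x})

lemma finite_endpoints (B : Fin n → Set State) : (endpoints B).Finite :=
  finite_iUnion fun _ => (Set.Subsingleton.finite fun _ h1 _ h2 => IsLeast.unique h1 h2).union
    (Set.Subsingleton.finite fun _ h1 _ h2 => IsGreatest.unique h1 h2)

lemma exists_lt {i : Fin n} {x : State} (hx : x ∉ endpoints B) {y : State} (hy : y ∈ B i)
    (hyx : y ≤ x) : ∃ y' ∈ B i, y' < x := by
  rcases hyx.lt_or_eq with hlt | rfl
  · exact ⟨y, hy, hlt⟩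
  by_contra! hcon
  exact hx (mem_iUnion.2 ⟨i, Or.inl ⟨hy, hcon⟩⟩)

lemma exists_gt {i : Fin n} {x : State} (hx : x ∉ endpoints B) {y : State} (hy : y ∈ B i)
    (hxy : x ≤ y) : ∃ y' ∈ B i, x < y' := by
  rcases hxy.lt_or_eq with hlt | rfl
  · exact ⟨y, hy, hlt⟩
  by_contra! hcon
  exact hx (mem_iUnion.2 ⟨i, Or.inr ⟨hy, hcon⟩⟩)

include h

/-- Away from the finitely many endpoints, weak betweenness can be made strict, which `not_between`
forbids. -/
lemma inter_subset_endpoints {i k : Fin n} (hik : i < k) : hull (B i) ∩ B k ⊆ endpoints B := by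
  rintro x ⟨hxi, hxk⟩
  by_contra hx
  obtain ⟨y, hy, z, hz, hyx, hxz⟩ := mem_hull_iff.1 hxi
  obtain ⟨y', hy', hyx'⟩ := exists_lt hx hy hyx
  obtain ⟨z', hz', hxz'⟩ := exists_gt hx hz hxz
  exact h.not_between i k hik x hxk y' hy' z' hz' hyx' hxz'

lemma inter_subset_endpoints_of_ne {i k : Fin n} (hik : i ≠ k) : B i ∩ B k ⊆ endpoints B := by
  rcases hik.lt_or_gt with hlt | hlt
  · exact (inter_subset_inter_left _ (subset_hull _)).trans (h.inter_subset_endpoints hlt)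
  · rw [inter_comm]
    exact (inter_subset_inter_left _ (subset_hull _)).trans (h.inter_subset_endpoints hlt)

lemma diff_endpoints_subset (k : Fin n) :
    B k \ endpoints B ⊆ hull (B k) \ ⋃ i < k, hull (B i) := by
  refine fun x hx => ⟨subset_hull _ hx.1, fun hmem => ?_⟩
  simp only [mem_iUnion] at hmem
  obtain ⟨i, hik, hi⟩ := hmem
  exact hx.2 (h.inter_subset_endpoints hik ⟨hi, hx.1⟩)

/-- A point of the hull outside `B k` lies strictly between points of `B k`, so the set covering it
cannot be a later one. -/
lemma hull_diff_subset (k : Fin n) : hull (B k) \ ⋃ i < k, hull (B i) ⊆ B k := by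
  rintro x ⟨hx, hnot⟩
  obtain ⟨i, hi⟩ := mem_iUnion.1 (h.covers ▸ mem_univ x)
  rcases lt_trichotomy i k with hik | rfl | hki
  · exact absurd (mem_iUnion₂.2 ⟨i, hik, subset_hull _ hi⟩) hnot
  · exact hi
  · obtain ⟨y, hy, z, hz, hyx, hxz⟩ := mem_hull_iff.1 hx
    rcases hyx.lt_or_eq with hyx | rfl
    · rcases hxz.lt_or_eq with hxz | rfl
      · exact absurd hxz (h.not_between k i hki x hi y hy z hz hyx)
      · exact hz
    · exact hy

/-- The endpoints are the only points of `B k` that earlier hulls can remove, and closure restores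
them because `B k` has no isolated points. -/
theorem isLaminar : IsLaminar B := fun k => by
  refine subset_antisymm ?_ (closure_minimal (h.hull_diff_subset k) (h.isClosed k))
  exact (h.subset_closure_diff k _ (finite_endpoints B)).trans
    (closure_mono (h.diff_endpoints_subset k))

lemma exists_mem_diff_endpoints {k : Fin n} (hk : (B k).Nonempty) :
    (B k \ endpoints B).Nonempty :=
  closure_nonempty_iff.1 (hk.mono (h.subset_closure_diff k _ (finite_endpoints B)))

/-- A point of `B k` that is no endpoint has points of `B k` on both sides; the open interval
between these, minus the closed earlier hulls, lies in `B k`. -/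
theorem interior_nonempty_iff (k : Fin n) : (interior (B k)).Nonempty ↔ (B k).Nonempty := by
  refine ⟨fun hk => hk.mono interior_subset, fun hk => ?_⟩
  obtain ⟨x, hx⟩ := h.exists_mem_diff_endpoints hk
  obtain ⟨y, hy, hyx⟩ := exists_lt hx.2 hx.1 le_rfl
  obtain ⟨z, hz, hxz⟩ := exists_gt hx.2 hx.1 le_rfl
  have hopen : IsOpen (Ioo y z \ ⋃ i < k, hull (B i)) := by
    refine isOpen_Ioo.sdiff ?_
    exact (Set.toFinite {i | i < k}).isClosed_biUnion fun i _ => isClosed_hull (h.isClosed i)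
  refine ⟨x, mem_interior.2 ⟨_, ?_, hopen, ⟨hyx, hxz⟩, (h.diff_endpoints_subset k hx).2⟩⟩
  refine (sdiff_subset_sdiff_left fun t ht => ?_).trans (h.hull_diff_subset k)
  exact mem_hull_iff.2 ⟨y, hy, z, hz, ht.1.le, ht.2.le⟩

theorem ordConnected_of_forall_lt {j : Fin n} (hj : ∀ i < j, B i = ∅) : (B j).OrdConnected := by
  have hlam := h.isLaminar j
  have hU : (⋃ i < j, hull (B i)) = ∅ := by
    simp only [iUnion_eq_empty]
    exact fun i hi => by rw [hj i hi, hull_empty]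
  rw [hU, sdiff_empty, (isClosed_hull (h.isClosed j)).closure_eq] at hlam
  rw [hlam]
  exact ordConnected_hull _

/-- If the first set of the cover is leftmost, it does not separate the later sets. -/
lemma le_of_leftmost {i k : Fin n} (hik : i < k) (hleft : ∀ x ∈ B k, ∃ y ∈ B i, y ≤ x)
    {x y : State} (hx : x ∈ B k) (hy : y ∈ B i) : y ≤ x := by
  have hsub : closure (B k \ endpoints B) ⊆ Ici y := by
    refine closure_minimal (fun t ht => ?_) isClosed_Ici
    by_contra hlt
    obtain ⟨y', hy', hle⟩ := hleft t ht.1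
    exact ht.2 (h.inter_subset_endpoints hik
      ⟨mem_hull_iff.2 ⟨y', hy', y, hy, hle, (not_le.1 hlt).le⟩, ht.1⟩)
  exact hsub (h.subset_closure_diff k _ (finite_endpoints B) hx)

/-- Going right, an interval of `B k` can only start at the least point of `B k` or where an earlier
hull ends. The set with index zero, being leftmost, cuts nothing, so at most `k` starting points
remain. -/
theorem isUnionOfDisjointIntervals
    (hleft : ∀ i : Fin n, (i : ℕ) = 0 → (B i).Nonempty → ∀ k, i < k → ∀ x ∈ B k, ∃ y ∈ B i, y ≤ x)
    {k : Fin n} (hk : 0 < (k : ℕ)) : IsUnionOfDisjointIntervals k (B k) := by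
  classical
  rcases (B k).eq_empty_or_nonempty with hem | hne
  · exact ⟨0, Nat.zero_le _, Fin.elim0, fun s => s.elim0, fun s => s.elim0, by simp [hem]⟩
  obtain ⟨m, hm⟩ := (h.isClosed k).isCompact.exists_isLeast hne
  have hmax : ∀ i, ∃ r, (B i).Nonempty → IsGreatest (B i) r := fun i => by
    by_cases hi : (B i).Nonempty
    · obtain ⟨r, hr⟩ := (h.isClosed i).isCompact.exists_isGreatest hi
      exact ⟨r, fun _ => hr⟩
    · exact ⟨m, fun h => absurd h hi⟩
  choose r hr using hmax
  let ι : Fin k → Fin n := Fin.castLE k.2.le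
  -- The slot of index zero is free for the least point `m`; this saves one interval. Empty sets
  -- also get the harmless value `m`.
  let x : Fin k → State := fun s => if (s : ℕ) ≠ 0 ∧ (B (ι s)).Nonempty then r (ι s) else m
  let C : Fin k → Set State := fun s => {y | x s ≤ y ∧ Icc (x s) y ⊆ B k}
  have hclosed : ∀ s, IsClosed (C s) := by
    refine fun s => isClosed_of_closure_subset fun y hy => ⟨?_, fun z hz => ?_⟩
    · exact closure_minimal (fun t ht => ht.1) (isClosed_Ici (a := x s)) hy
    · rcases hz.2.lt_or_eq with hlt | rfl
      · obtain ⟨y', hy', hC⟩ := mem_closure_iff.1 hy (Ioi z) isOpen_Ioi hlt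
        exact hC.2 ⟨hz.1, le_of_lt hy'⟩
      · exact closure_minimal (fun t ht => ht.2 (right_mem_Icc.2 ht.1)) (h.isClosed k) hy
  have hdense : B k \ endpoints B ⊆ ⋃ s, C s := by
    intro y hy
    have hyL := h.diff_endpoints_subset k hy
    let s₀ : Fin k := ⟨0, hk⟩
    have hx₀ : x s₀ = m := by simp [x, s₀]
    -- Take the last starting point before `y`. An earlier hull meeting the stretch from there to
    -- `y` would either end inside it, against maximality, or reach `y`, which lies in no earlier
    -- hull.
    obtain ⟨s, hs, hsmax⟩ := (Finset.univ.filter fun s => x s ≤ y).exists_max_image x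
      ⟨s₀, by simpa [hx₀] using hm.2 hy.1⟩
    simp only [Finset.mem_filter, Finset.mem_univ, true_and] at hs hsmax
    have hms : m ≤ x s := hx₀ ▸ hsmax s₀ (by simpa [hx₀] using hm.2 hy.1)
    have hIoc : Ioc (x s) y ⊆ B k := by
      intro z hz
      refine h.hull_diff_subset k ⟨mem_hull_iff.2 ⟨m, hm.1, y, hy.1, hms.trans hz.1.le, hz.2⟩, ?_⟩
      intro hmem
      obtain ⟨i, hik, hi⟩ := mem_iUnion₂.1 hmem
      obtain ⟨a, ha, b, hb, haz, hzb⟩ := mem_hull_iff.1 hi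
      by_cases hi0 : (i : ℕ) = 0
      · have := h.le_of_leftmost hik (hleft i hi0 ⟨a, ha⟩ k hik) hm.1 hb
        exact absurd (hzb.trans (this.trans hms)) (not_le.2 hz.1)
      · have hxi : x ⟨i, hik⟩ = r i := by
          have : ι ⟨i, hik⟩ = i := rfl
          simp only [x, this]
          rw [if_pos ⟨hi0, a, ha⟩]
        have hbr : b ≤ r i := (hr i ⟨a, ha⟩).2 hb
        rcases le_or_gt (r i) y with hle | hgt
        · have := hsmax ⟨i, hik⟩ (hxi.trans_le hle)
          rw [hxi] at this
          exact absurd (hzb.trans (hbr.trans this)) (not_le.2 hz.1)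
        · exact hyL.2 (mem_iUnion₂.2 ⟨i, hik, mem_hull_iff.2
            ⟨a, ha, r i, (hr i ⟨a, ha⟩).1, haz.trans hz.2, hgt.le⟩⟩)
    refine mem_iUnion.2 ⟨s, hs, ?_⟩
    rcases hs.lt_or_eq with hlt | heq
    · rw [← closure_Ioc hlt.ne]
      exact closure_minimal hIoc (h.isClosed k)
    · rw [heq, Icc_self]
      exact singleton_subset_iff.2 hy.1
  have hcover : B k ⊆ ⋃ s, C s :=
    (h.subset_closure_diff k _ (finite_endpoints B)).trans
      (closure_minimal hdense (isClosed_iUnion_of_finite hclosed))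
  refine isUnionOfDisjointIntervals_of_ordConnectedComponent x fun y hy => ?_
  obtain ⟨s, hs⟩ := mem_iUnion.1 (hcover hy)
  exact ⟨s, by rw [mem_ordConnectedComponent, uIcc_of_le hs.1]; exact hs.2⟩

end IsNestedCover

/-! ### Supports of the choosers at an optimum -/

namespace Game

variable {n : ℕ} (G : Game n) {κ : Kernel State (Fin n)}

lemma choosers_ne_zero_of_mem {k : Fin n} {x : State} (hx : x ∈ (G.choosers κ k).support)
    {U : Set State} (hU : IsOpen U) (hxU : x ∈ U) : G.choosers κ k U ≠ 0 :=
  (Measure.mem_support_iff_forall x |>.1 hx U (hU.mem_nhds hxU)).ne'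

variable [IsMarkovKernel κ]

instance nullSingletonClass_choosers (k : Fin n) : NullSingletonClass (G.choosers κ k) where
  measure_singleton x := le_antisymm
    ((G.choosers_le_prior κ k _).trans (measure_singleton x).le) (zero_le)

/-- The complement is open and null for the prior, which charges every nonempty open set. -/
lemma iUnion_support_choosers : ⋃ k, (G.choosers κ k).support = univ := by
  have hclosed : IsClosed (⋃ k, (G.choosers κ k).support) :=
    isClosed_iUnion_of_finite fun k => Measure.isClosed_support
  have hnull : G.prior (⋃ k, (G.choosers κ k).support)ᶜ = 0 := by
    rw [← G.sum_choosers κ]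
    simp only [Measure.coe_finsetSum, Finset.sum_apply, Finset.sum_eq_zero_iff, Finset.mem_univ,
      true_imp_iff]
    exact fun k => measure_mono_null (compl_subset_compl.2 (subset_iUnion _ k))
      Measure.measure_compl_support
  exact compl_empty_iff.1 ((hclosed.isOpen_compl.measure_eq_zero_iff G.prior).1 hnull)

/-- Nestedness is `choosers_Icc` with `p`, `q` inserted between the points so that the rays and the
middle interval carry mass. There are no isolated points because the choosers have no atoms. -/
theorem IsLexOptimal.isNestedCover (h : G.IsLexOptimal κ) :
    IsNestedCover fun k => (G.choosers κ k).support where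
  isClosed k := Measure.isClosed_support
  covers := G.iUnion_support_choosers
  not_between i k hik x hx y hy z hz hyx hxz := by
    obtain ⟨p, hyp, hpx⟩ := exists_between hyx
    obtain ⟨q, hxq, hqz⟩ := exists_between hxz
    have hzero := h.choosers_Icc G hik (p := p) (q := q)
      (G.choosers_ne_zero_of_mem hy isOpen_Iio hyp) (G.choosers_ne_zero_of_mem hz isOpen_Ioi hqz)
      (hpx.trans hxq).le
    exact G.choosers_ne_zero_of_mem hx isOpen_Ioo ⟨hpx, hxq⟩
      (measure_mono_null Ioo_subset_Icc_self hzero)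
  subset_closure_diff k E hE := by
    refine Measure.support_subset_of_isClosed isClosed_closure ?_
    rw [mem_ae_iff]
    refine measure_mono_null (t := (G.choosers κ k).supportᶜ ∪ E) (fun x hx => ?_)
      (measure_union_null Measure.measure_compl_support (hE.measure_zero _))
    by_contra hcon
    simp only [mem_union, mem_compl_iff, not_or, not_not] at hcon
    exact hx (subset_closure ⟨hcon.1, hcon.2⟩)

theorem IsValueMaximal.support_leftmost (h : G.IsValueMaximal κ) {i : Fin n} (hi : (i : ℕ) = 0)
    (hne : (G.choosers κ i).support.Nonempty) {k : Fin n} (hik : i < k) {x : State}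
    (hx : x ∈ (G.choosers κ k).support) : ∃ y ∈ (G.choosers κ i).support, y ≤ x := by
  obtain ⟨y, hy⟩ := hne
  by_contra! hcon
  obtain ⟨p, hxp, hpy⟩ := exists_between (hcon y hy)
  have hzero := h.choosers_Iic G hi hik (p := p) (G.choosers_ne_zero_of_mem hy isOpen_Ioi hpy)
  exact G.choosers_ne_zero_of_mem hx isOpen_Iio hxp (measure_mono_null Iio_subset_Iic_self hzero)

theorem IsLexOptimal.isDeterministicRepresentation (h : G.IsLexOptimal κ) :
    IsDeterministicRepresentation G fun k => (G.choosers κ k).support where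
  isClosed := h.isNestedCover.isClosed
  covers := h.isNestedCover.covers
  overlap_null _ _ hik := measure_mono_null (h.isNestedCover.inter_subset_endpoints_of_ne hik)
    ((IsNestedCover.finite_endpoints _).measure_zero _)

/-- At an optimum, the choice of actions is deterministic. -/
theorem IsLexOptimal.restrict_support (h : G.IsLexOptimal κ) (k : Fin n) :
    G.prior.restrict (G.choosers κ k).support = G.choosers κ k := by
  have hm : ∀ i, MeasurableSet (G.choosers κ i).support := fun i =>
    Measure.isClosed_support.measurableSet
  ext A hA
  rw [Measure.restrict_apply hA]
  conv_lhs => rw [← G.sum_choosers κ]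
  rw [Measure.coe_finsetSum, Finset.sum_apply, Finset.sum_eq_single k]
  · exact measure_congr (inter_ae_eq_left_of_ae_eq_univ
      (eventuallyEq_univ.2 Measure.support_mem_ae))
  · intro i _ hik
    refine measure_mono_null (t := (G.choosers κ i).supportᶜ ∪
      (G.choosers κ i).support ∩ (G.choosers κ k).support) (fun x hx => ?_)
      (measure_union_null Measure.measure_compl_support
        (measure_mono_null (h.isNestedCover.inter_subset_endpoints_of_ne hik)
          ((IsNestedCover.finite_endpoints _).measure_zero _)))
    by_cases hxi : x ∈ (G.choosers κ i).support
    · exact Or.inr ⟨hxi, hx.2⟩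
    · exact Or.inl hxi
  · simp

end Game

/-! ### Extreme optimal actions as functions of the mean -/

namespace Game

variable {n : ℕ} (G : Game n)

/-- The highest action that is optimal at a given mean depends measurably on the mean. -/
lemma exists_highest_action : ∃ t : ℝ → Fin n, Measurable t ∧ ∀ x, 0 ≤ x →
    G.cutoff (t x).castSucc ≤ x ∧ ∀ k : Fin n, G.cutoff k.castSucc ≤ x → k ≤ t x := by
  have := G.neZero
  let s : ℝ → Finset (Fin n) := fun x => Finset.univ.filter fun k => G.cutoff k.castSucc ≤ x
  have hmono : Monotone fun x => (s x).sup id := fun x y hxy => Finset.sup_mono fun k hk => by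
    simp only [s, Finset.mem_filter, Finset.mem_univ, true_and] at hk ⊢
    exact hk.trans hxy
  refine ⟨fun x => (s x).sup id, hmono.measurable, fun x hx => ⟨?_, fun k hk => ?_⟩⟩
  · have hne : (s x).Nonempty := ⟨0, by
      simp only [s, Finset.mem_filter, Finset.mem_univ, true_and, Fin.castSucc_zero']
      rwa [G.cutoff_zero]⟩
    obtain ⟨k, hk, heq⟩ := Finset.exists_mem_eq_sup _ hne (id : Fin n → Fin n)
    simp only [heq, id]
    simpa [s] using hk
  · exact Finset.le_sup (f := id) (by simpa [s] using hk)

/-- The lowest action that is optimal at a given mean depends measurably on the mean. -/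
lemma exists_lowest_action : ∃ b : ℝ → Fin n, Measurable b ∧ ∀ x ∈ Icc (0 : ℝ) 1,
    x ∈ G.optimalRegion (b x) ∧ ∀ k : Fin n, x ≤ G.cutoff k.succ → b x ≤ k := by
  have := G.neZero
  let s : ℝ → Finset (Fin n) := fun x => Finset.univ.filter fun k => x ≤ G.cutoff k.succ
  have hmono : Monotone fun x => (s x).inf id := fun x y hxy => Finset.inf_mono fun k hk => by
    simp only [s, Finset.mem_filter, Finset.mem_univ, true_and] at hk ⊢
    exact hxy.trans hk
  refine ⟨fun x => (s x).inf id, hmono.measurable, fun x hx => ?_⟩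
  have hle : ∀ k : Fin n, x ≤ G.cutoff k.succ → (s x).inf id ≤ k := fun k hk =>
    Finset.inf_le (f := id) (by simpa [s] using hk)
  refine ⟨?_, hle⟩
  have hne : (s x).Nonempty := by
    obtain ⟨m, rfl⟩ := Nat.exists_eq_succ_of_ne_zero this.out
    refine ⟨Fin.last m, ?_⟩
    simp only [s, Finset.mem_filter, Finset.mem_univ, true_and, Fin.succ_last]
    rw [G.cutoff_last]; exact hx.2
  obtain ⟨k, hk, heq⟩ := Finset.exists_mem_eq_inf _ hne (id : Fin n → Fin n)
  simp only [id] at heq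
  rw [heq] at hle
  simp only [heq]
  refine ⟨?_, by simpa [s] using hk⟩
  by_contra! hlt
  have hk0 : (k : ℕ) ≠ 0 := fun h0 => by
    have : k.castSucc = 0 := Fin.ext h0
    rw [this, G.cutoff_zero] at hlt
    exact absurd hx.1 (not_le.2 hlt)
  have hlt' : (k : ℕ) - 1 < n := by omega
  -- If the mean were below the lower cutoff of `a_k`, the preceding action would also satisfy the
  -- defining inequality, against minimality.
  have := hle ⟨(k : ℕ) - 1, hlt'⟩ (by
    have : (⟨(k : ℕ) - 1, hlt'⟩ : Fin n).succ = k.castSucc := Fin.ext (by simp; omega)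
    rw [this]; exact hlt.le)
  rw [Fin.le_def] at this
  simp only at this
  omega

end Game

/-! ### The relaxed value bounds every equilibrium payoff -/

namespace Profile

variable {n : ℕ} (e : Profile n) (G : Game n)

attribute [instance] Profile.sender_markov Profile.receiver_markov Profile.belief_markov

lemma measurable_messageValue : Measurable (e.messageValue G) :=
  Finset.measurable_sum _ fun i _ => ((e.receiver.measurable_coe
    (measurableSet_singleton i)).ennreal_toReal).mul_const _

lemma measurable_posteriorMean : Measurable e.posteriorMean :=
  (StronglyMeasurable.integral_kernel (κ := e.belief)
    (measurable_subtype_coe : Measurable fun ω : State => (ω : ℝ)).stronglyMeasurable).measurable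

lemma posteriorMean_nonneg (m : Message) : 0 ≤ e.posteriorMean m :=
  integral_nonneg fun ω => ω.2.1

lemma sum_receiver (m : Message) : ∑ i, (e.receiver m).real {i} = 1 := by
  simp

lemma messageValue_le_of_forall {m : Message} {c : ℝ}
    (h : ∀ i, 0 < e.receiver m {i} → G.payoff i ≤ c) : e.messageValue G m ≤ c := by
  calc e.messageValue G m ≤ ∑ i, (e.receiver m).real {i} * c := Finset.sum_le_sum fun i _ => by
        rcases eq_zero_or_pos (e.receiver m {i}) with h0 | hpos
        · simp [Measure.real, h0]
        · exact mul_le_mul_of_nonneg_left (h i hpos) measureReal_nonneg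
    _ = c := by rw [← Finset.sum_mul, sum_receiver, one_mul]

lemma lt_messageValue_of_forall {m : Message} {c : ℝ}
    (h : ∀ i, 0 < e.receiver m {i} → c < G.payoff i) : c < e.messageValue G m := by
  calc c = ∑ i, (e.receiver m).real {i} * c := by rw [← Finset.sum_mul, sum_receiver, one_mul]
    _ < e.messageValue G m := by
        obtain ⟨i, -, hi⟩ : ∃ i ∈ Finset.univ, 0 < (e.receiver m).real {i} :=
          Finset.exists_lt_of_sum_lt (by simp)
        refine Finset.sum_lt_sum (fun i _ => ?_) ⟨i, Finset.mem_univ i, ?_⟩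
        · rcases eq_zero_or_pos (e.receiver m {i}) with h0 | hpos
          · simp [Measure.real, h0]
          · exact mul_le_mul_of_nonneg_left (h i hpos).le measureReal_nonneg
        · exact mul_lt_mul_of_pos_left (h i (ENNReal.toReal_pos_iff.1 hi).1) hi

lemma abs_messageValue_le (m : Message) : |e.messageValue G m| ≤ ∑ i, |G.payoff i| := by
  refine (Finset.abs_sum_le_sum_abs _ _).trans (Finset.sum_le_sum fun i _ => ?_)
  rw [abs_mul, abs_of_nonneg measureReal_nonneg]
  exact mul_le_of_le_one_left (abs_nonneg _) measureReal_le_one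

lemma integrable_messageValue (μ : Measure Message) [IsFiniteMeasure μ] :
    Integrable (e.messageValue G) μ :=
  Integrable.of_bound (e.measurable_messageValue G).aestronglyMeasurable _
    (Eventually.of_forall (e.abs_messageValue_le G))

variable {e G}

/-- After a fully revealing message, the posterior mean is the state. -/
lemma IsEquilibrium.posteriorMean_singleton (h : e.IsEquilibrium G) (ω : State) :
    e.posteriorMean {ω} = ω := by
  have hsupp := h.belief_support {ω}
  have hae : ∀ᵐ x ∂(e.belief {ω}), x = ω := by
    rw [ae_iff]
    refine measure_mono_null (fun x hx => ?_) hsupp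
    simpa using hx
  rw [posteriorMean, integral_congr_ae (g := fun _ => (ω : ℝ)) (hae.mono fun x hx => by simp [hx])]
  simp

/-- The choice of actions in which the Receiver breaks ties in favor of the Sender. -/
def inducedKernel (e : Profile n) (t : ℝ → Fin n) : Kernel State (Fin n) :=
  e.sender.map fun m => t (e.posteriorMean m)

variable {t : ℝ → Fin n} (ht : Measurable t)
include ht

lemma isMarkovKernel_inducedKernel : IsMarkovKernel (e.inducedKernel t) :=
  Kernel.IsMarkovKernel.map _ (ht.comp e.measurable_posteriorMean)

lemma share_inducedKernel (k : Fin n) (ω : State) : share (e.inducedKernel t) k ω =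
    (e.sender ω).real {m | t (e.posteriorMean m) = k} := by
  have htm : Measurable fun m => t (e.posteriorMean m) := ht.comp e.measurable_posteriorMean
  rw [share, inducedKernel, Measure.real, Kernel.map_apply' _ htm _ (measurableSet_singleton k)]
  rfl

variable (hspec : ∀ x, 0 ≤ x →
    G.cutoff (t x).castSucc ≤ x ∧ ∀ k : Fin n, G.cutoff k.castSucc ≤ x → k ≤ t x)
include hspec

omit ht in
lemma IsEquilibrium.messageValue_le (h : e.IsEquilibrium G) (m : Message) :
    e.messageValue G m ≤ G.payoff (t (e.posteriorMean m)) :=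
  e.messageValue_le_of_forall G fun i hi => G.payoff_strictMono.monotone
    ((hspec _ (e.posteriorMean_nonneg m)).2 i (h.receiver_optimal m i hi).1)

/-- By Bayes' rule the surplus of `a_k` is the integral of the posterior mean minus the cutoff over
messages answered by `a_k`, where it is nonnegative. A state above the upper cutoff of `a_k` earns
strictly more by disclosing itself than any message answered by `a_k` can yield. -/
theorem IsEquilibrium.isFeasible_inducedKernel (h : e.IsEquilibrium G) :
    G.IsFeasible (e.inducedKernel t) := by
  have htm : Measurable fun m => t (e.posteriorMean m) := ht.comp e.measurable_posteriorMean
  refine ⟨fun k => ?_, fun k => Eventually.of_forall fun ω hω => ?_⟩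
  · set T : Set Message := {m | t (e.posteriorMean m) = k}
    have hT : MeasurableSet T := htm (measurableSet_singleton k)
    let f : Message × State → ℝ := fun x =>
      T.indicator (fun _ => (1 : ℝ)) x.1 * ((x.2 : ℝ) - G.cutoff k.castSucc)
    have hf : Measurable f := ((measurable_const.indicator hT).comp measurable_fst).mul
      ((measurable_subtype_coe.comp measurable_snd).sub_const _)
    have hfb : ∀ x, ‖f x‖ ≤ 1 := fun x => by
      simp only [f, norm_mul]
      refine mul_le_one₀ ?_ (norm_nonneg _) (G.abs_state_sub_cutoff_le _ _)
      by_cases hx : x.1 ∈ T <;> simp [hx]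
    have e1 : G.surplus (e.inducedKernel t) k =
        ∫ x, f x ∂((e.sender ∘ₘ G.prior) ⊗ₘ e.belief) := by
      have hint : Integrable (fun x : State × Message => f x.swap) (G.prior ⊗ₘ e.sender) :=
        Integrable.of_bound (hf.comp measurable_swap).aestronglyMeasurable 1
          (Eventually.of_forall fun x => hfb _)
      rw [h.bayes, integral_map measurable_swap.aemeasurable hf.aestronglyMeasurable,
        Measure.integral_compProd hint]
      refine integral_congr_ae (Eventually.of_forall fun ω => ?_)
      simp only [f, Prod.swap_prod_mk]
      rw [integral_mul_const, integral_indicator_const _ hT, share_inducedKernel ht]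
      simp [T]
    rw [e1, Measure.integral_compProd (Integrable.of_bound hf.aestronglyMeasurable 1
      (Eventually.of_forall hfb))]
    refine integral_nonneg fun m => ?_
    simp only [f, Pi.zero_apply]
    rw [integral_const_mul, integral_sub (integrable_of_continuous (by fun_prop))
      (integrable_const _)]
    by_cases hm : m ∈ T
    · have := (hspec _ (e.posteriorMean_nonneg m)).1
      rw [show t (e.posteriorMean m) = k from hm] at this
      simpa [hm, posteriorMean] using this
    · simp [hm]
  · rw [share_inducedKernel ht, measureReal_eq_zero_iff, ← nonpos_iff_eq_zero]
    have hae := h.sender_optimal ω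
    have : ∀ᵐ m ∂(e.sender ω), ¬ t (e.posteriorMean m) = k := by
      filter_upwards [hae] with m hm hk
      have h1 := hm {ω} (by simp)
      have h2 := h.messageValue_le hspec m
      rw [hk] at h2
      refine absurd (h1.trans h2) (not_le.2 (e.lt_messageValue_of_forall G fun i hi => ?_))
      have h3 := h.receiver_optimal {ω} i hi
      rw [h.posteriorMean_singleton] at h3
      refine G.payoff_strictMono ?_
      by_contra! hle
      exact absurd (h3.2.trans (G.cutoff_mono (Fin.succ_le_succ_iff.2 hle))) (not_le.2 hω)
    rw [ae_iff] at this
    simpa using this.le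

theorem IsEquilibrium.exAntePayoff_le (h : e.IsEquilibrium G) :
    e.exAntePayoff G ≤ G.value (e.inducedKernel t) := by
  have htm : Measurable fun m => t (e.posteriorMean m) := ht.comp e.measurable_posteriorMean
  have hMarkov := isMarkovKernel_inducedKernel (e := e) ht
  have hin : ∀ ω, ∫ m, e.messageValue G m ∂(e.sender ω) ≤
      ∑ k, share (e.inducedKernel t) k ω * G.payoff k := by
    intro ω
    have e1 : ∑ k, share (e.inducedKernel t) k ω * G.payoff k =
        ∫ m, G.payoff (t (e.posteriorMean m)) ∂(e.sender ω) := by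
      have := integral_fintype (μ := e.inducedKernel t ω) (f := G.payoff) .of_finite
      rw [inducedKernel, Kernel.map_apply _ htm, integral_map htm.aemeasurable
        (measurable_of_finite _).aestronglyMeasurable] at this
      rw [this]
      simp [share, inducedKernel, Kernel.map_apply _ htm]
    rw [e1]
    refine integral_mono (e.integrable_messageValue G _) ?_ (h.messageValue_le hspec)
    exact Integrable.of_bound ((measurable_of_finite G.payoff).comp htm).aestronglyMeasurable
      (∑ i, |G.payoff i|) (Eventually.of_forall fun m =>
        Finset.single_le_sum (f := fun i => |G.payoff i|) (fun _ _ => abs_nonneg _)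
          (Finset.mem_univ _))
  refine integral_mono ?_ ?_ hin
  · refine Integrable.of_bound (StronglyMeasurable.integral_kernel
      (e.measurable_messageValue G).stronglyMeasurable).aestronglyMeasurable (∑ i, |G.payoff i|)
      (Eventually.of_forall fun ω => ?_)
    refine (norm_integral_le_of_norm_le_const (C := ∑ i, |G.payoff i|)
      (Eventually.of_forall (e.abs_messageValue_le G))).trans ?_
    simp
  · exact integrable_finsetSum _ fun k _ => (integrable_share _ k).mul_const _

end Profile

/-! ### Measurable selections from messages -/

section Selection

variable {X : Type*} [MeasurableSpace X] {n : ℕ}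

lemma measurable_comp_mem {β : Type*} [MeasurableSpace β] {A : Fin n → Set X}
    (hA : ∀ k, MeasurableSet (A k)) (F : (Fin n → Prop) → β) :
    Measurable fun x => F fun k => x ∈ A k :=
  (measurable_of_finite F).comp (measurable_pi_iff.2 fun k => measurable_mem.2 (hA k))

lemma exists_measurable_greatest [NeZero n] {A : Fin n → Set X} (hA : ∀ k, MeasurableSet (A k)) :
    ∃ f : X → Fin n, Measurable f ∧ ∀ x i, x ∈ A i → x ∈ A (f x) ∧ i ≤ f x := by
  classical
  have h : ∀ P : Fin n → Prop, ∃ m, ∀ i, P i → P m ∧ i ≤ m := by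
    intro P
    by_cases hP : (Finset.univ.filter P).Nonempty
    · obtain ⟨m, hm, hmax⟩ := (Finset.univ.filter P).exists_max_image id hP
      exact ⟨m, fun i hi => ⟨by simpa using hm, hmax i (by simpa using hi)⟩⟩
    · exact ⟨0, fun i hi => absurd ⟨i, by simpa using hi⟩ hP⟩
  choose F hF using h
  exact ⟨_, measurable_comp_mem hA F, fun x => hF _⟩

lemma exists_measurable_least [NeZero n] {A : Fin n → Set X} (hA : ∀ k, MeasurableSet (A k)) :
    ∃ f : X → Fin n, Measurable f ∧ ∀ x i, x ∈ A i → x ∈ A (f x) ∧ f x ≤ i := by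
  classical
  have h : ∀ P : Fin n → Prop, ∃ m, ∀ i, P i → P m ∧ m ≤ i := by
    intro P
    by_cases hP : (Finset.univ.filter P).Nonempty
    · obtain ⟨m, hm, hmin⟩ := (Finset.univ.filter P).exists_min_image id hP
      exact ⟨m, fun i hi => ⟨by simpa using hm, hmin i (by simpa using hi)⟩⟩
    · exact ⟨0, fun i hi => absurd ⟨i, by simpa using hi⟩ hP⟩
  choose F hF using h
  exact ⟨_, measurable_comp_mem hA F, fun x => hF _⟩

lemma measurableSet_inter_nonempty {C : Set State} (hC : IsClosed C) :
    MeasurableSet {m : Message | ((m : Set State) ∩ C).Nonempty} :=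
  (TopologicalSpace.NonemptyCompacts.isClosed_inter_nonempty_of_isClosed hC).measurableSet

/-- The lowest element of `m ∩ C` depends measurably on `m`. -/
lemma exists_measurable_mem_inter {C : Set State} (hC : IsClosed C) :
    ∃ s : Message → State, Measurable s ∧
      ∀ m : Message, ((m : Set State) ∩ C).Nonempty → s m ∈ (m : Set State) ∩ C := by
  classical
  have h : ∀ m : Message, ∃ x, (((m : Set State) ∩ C).Nonempty → IsLeast ((m : Set State) ∩ C) x) ∧
      (¬ ((m : Set State) ∩ C).Nonempty → x = 0) := by
    intro m
    by_cases hm : ((m : Set State) ∩ C).Nonempty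
    · obtain ⟨x, hx⟩ := (m.isCompact.inter_right hC).exists_isLeast hm
      exact ⟨x, fun _ => hx, fun h => absurd hm h⟩
    · exact ⟨0, fun h => absurd h hm, fun _ => rfl⟩
  choose s hs hs0 using h
  refine ⟨s, measurable_of_Iic fun x => ?_, fun m hm => (hs m hm).1⟩
  -- Messages that miss `C` get the default `0`, so all of them belong to the preimage.
  have : s ⁻¹' Iic x = {m : Message | ((m : Set State) ∩ (C ∩ Iic x)).Nonempty} ∪
      {m : Message | ((m : Set State) ∩ C).Nonempty}ᶜ := by
    ext m
    simp only [mem_preimage, mem_Iic, mem_union, mem_compl_iff]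
    by_cases hm : ((m : Set State) ∩ C).Nonempty
    · refine ⟨fun hle => Or.inl ⟨s m, (hs m hm).1.1, (hs m hm).1.2, hle⟩, ?_⟩
      rintro (⟨y, hy, hyC, hyx⟩ | hcon)
      · exact ((hs m hm).2 ⟨hy, hyC⟩).trans hyx
      · exact absurd hm hcon
    · refine ⟨fun _ => Or.inr hm, fun _ => ?_⟩
      rw [hs0 m hm]; exact x.2.1
  rw [this]
  exact (measurableSet_inter_nonempty (hC.inter isClosed_Iic)).union
    (measurableSet_inter_nonempty hC).compl

lemma measurableSet_coe_eq (C : Set State) : MeasurableSet {m : Message | (m : Set State) = C} :=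
  Set.Subsingleton.measurableSet fun _ h1 _ h2 => SetLike.coe_injective (h1.trans h2.symm)

end Selection

/-! ### Obedient representations are implemented by equilibria -/

namespace Game

variable {n : ℕ} (G : Game n)

/-- A representation by non-null sets at which recommending action `a_k` on `B_k` is obedient and
in which no state gains from disclosing itself. -/
structure IsObedient (B : Fin n → Set State) : Prop where
  representation : IsDeterministicRepresentation G B
  prior_ne_zero : ∀ k, (B k).Nonempty → G.prior (B k) ≠ 0
  le_cutoff : ∀ k, ∀ ω ∈ B k, (ω : ℝ) ≤ G.cutoff k.succ
  cutoff_le_condMean : ∀ k, (B k).Nonempty → G.cutoff k.castSucc ≤ G.condMean (B k)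

variable {G} {B : Fin n → Set State} (h : G.IsObedient B)
include h

lemma IsObedient.eq_of_eq {i k : Fin n} (hne : (B i).Nonempty) (hik : B i = B k) : i = k := by
  by_contra hcon
  have := h.representation.overlap_null i k hcon
  rw [← hik, inter_self] at this
  exact h.prior_ne_zero i hne this

lemma IsObedient.condMean_mem (k : Fin n) (hne : (B k).Nonempty) :
    G.condMean (B k) ∈ G.optimalRegion k := by
  refine ⟨h.cutoff_le_condMean k hne, ?_⟩
  have := cond_isProbabilityMeasure (h.prior_ne_zero k hne)
  have hae : ∀ᵐ ω : State ∂(G.prior[|B k]), (ω : ℝ) ≤ G.cutoff k.succ :=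
    (ae_cond_mem (h.representation.isClosed k).measurableSet).mono fun ω hω => h.le_cutoff k ω hω
  calc G.condMean (B k) ≤ ∫ _ω, G.cutoff k.succ ∂(G.prior[|B k]) :=
        integral_mono_ae (integrable_of_continuous (by fun_prop)) (integrable_const _) hae
    _ = G.cutoff k.succ := by simp

/-- Obedient actions, and skeptical beliefs after messages that are not recommendations. -/
lemma IsObedient.exists_response : ∃ (a : Message → Fin n) (p : Kernel Message State),
    Measurable a ∧ IsMarkovKernel p ∧
    (∀ (k : Fin n) (m : Message), (m : Set State) = B k → a m = k ∧ p m = G.prior[|B k]) ∧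
    (∀ (m : Message), ∀ ω ∈ m, ∃ i, ω ∈ B i ∧ a m ≤ i) ∧
    (∀ m, ∫ ω : State, (ω : ℝ) ∂(p m) ∈ G.optimalRegion (a m)) ∧
    ∀ m : Message, p m (m : Set State)ᶜ = 0 := by
  classical
  have := G.neZero
  have hcl := h.representation.isClosed
  obtain ⟨g, hg, hgspec⟩ := exists_measurable_greatest fun k => measurableSet_coe_eq (B k)
  obtain ⟨r, hr, hrspec⟩ := exists_measurable_least fun k => measurableSet_inter_nonempty (hcl k)
  obtain ⟨b, hb, hbspec⟩ := G.exists_lowest_action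
  choose s hs hsspec using fun k => exists_measurable_mem_inter (hcl k)
  set P : Set Message := ⋃ k, {m : Message | (m : Set State) = B k}
  have hP : MeasurableSet P := MeasurableSet.iUnion fun k => measurableSet_coe_eq (B k)
  have hgP : ∀ m ∈ P, (m : Set State) = B (g m) := fun m hm =>
    let ⟨i, hi⟩ := mem_iUnion.1 hm
    (hgspec m i hi).1
  have hgeq : ∀ (k : Fin n) (m : Message), (m : Set State) = B k → g m = k := fun k m hm =>
    h.eq_of_eq (by rw [← (hgspec m k hm).1]; exact m.nonempty) ((hgspec m k hm).1.symm.trans hm)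
  have hrspec' : ∀ m : Message, ∀ ω ∈ m, ∃ i, ω ∈ B i ∧
      ((m : Set State) ∩ B (r m)).Nonempty ∧ r m ≤ i := by
    intro m ω hω
    obtain ⟨i, hi⟩ := mem_iUnion.1 (h.representation.covers ▸ mem_univ ω)
    exact ⟨i, hi, hrspec m i ⟨ω, hω, hi⟩⟩
  -- Skeptical belief: a point mass at a state of `m` in the set of lowest index that `m` meets.
  let w : Message → State := fun m => s (r m) m
  have hw : Measurable w := by
    have : Measurable fun x : Fin n × Message => s x.1 x.2 :=
      measurable_from_prod_countable_right hs
    exact this.comp (hr.prodMk measurable_id)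
  have hwmem : ∀ m : Message, w m ∈ (m : Set State) ∩ B (r m) := fun m =>
    let ⟨ω, hω⟩ := m.nonempty
    let ⟨_, _, hne, _⟩ := hrspec' m ω hω
    hsspec (r m) m hne
  let c : Fin n → Measure State := fun k => if (B k).Nonempty then G.prior[|B k] else G.prior
  have hc : ∀ k, IsProbabilityMeasure (c k) := fun k => by
    by_cases hne : (B k).Nonempty
    · simp only [c, hne, if_true]
      exact cond_isProbabilityMeasure (h.prior_ne_zero k hne)
    · simp only [c, hne, if_false]
      infer_instance
  let p₁ : Kernel Message State := (Kernel.ofFunOfCountable c).comap g hg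
  have hp₁ : IsMarkovKernel p₁ := ⟨fun m => hc (g m)⟩
  let p : Kernel Message State := Kernel.piecewise hP p₁ (Kernel.deterministic w hw)
  let a : Message → Fin n := fun m => if m ∈ P then g m else b (w m)
  have hpP : ∀ m ∈ P, p m = G.prior[|B (g m)] := by
    intro m hm
    have hne : (B (g m)).Nonempty := by rw [← hgP m hm]; exact m.nonempty
    simp only [p, Kernel.piecewise_apply, hm, if_true]
    change c (g m) = _
    simp only [c, hne, if_true]
  have hpP' : ∀ m ∉ P, p m = Measure.dirac (w m) := by
    intro m hm
    simp [p, Kernel.piecewise_apply, hm, Kernel.deterministic_apply]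
  have haP : ∀ m ∈ P, a m = g m := fun m hm => if_pos hm
  have haP' : ∀ m ∉ P, a m = b (w m) := fun m hm => if_neg hm
  refine ⟨a, p, Measurable.ite hP hg (hb.comp (measurable_subtype_coe.comp hw)), inferInstance,
    fun k m hm => ?_, fun m ω hω => ?_, fun m => ?_, fun m => ?_⟩
  · have hmP : m ∈ P := mem_iUnion.2 ⟨k, hm⟩
    rw [haP m hmP, hpP m hmP, hgeq k m hm]
    exact ⟨rfl, rfl⟩
  · by_cases hm : m ∈ P
    · refine ⟨g m, ?_, (haP m hm).le⟩
      rw [← hgP m hm]; exact hω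
    · obtain ⟨i, hi, -, hri⟩ := hrspec' m ω hω
      refine ⟨i, hi, ?_⟩
      rw [haP' m hm]
      -- The state `w m` is below the upper cutoff of `a_(r m)`, so the lowest optimal action is at
      -- most `r m`, the least index that `m` meets.
      exact ((hbspec _ (w m).2).2 _ (h.le_cutoff _ _ (hwmem m).2)).trans hri
  · by_cases hm : m ∈ P
    · rw [hpP m hm, haP m hm]
      exact h.condMean_mem _ (by rw [← hgP m hm]; exact m.nonempty)
    · rw [hpP' m hm, haP' m hm, integral_dirac]
      exact (hbspec _ (w m).2).1
  · by_cases hm : m ∈ P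
    · rw [hpP m hm, hgP m hm, cond_apply (hcl _).measurableSet, inter_compl_self]
      simp
    · rw [hpP' m hm, Measure.dirac_apply' _ m.isCompact.measurableSet.compl]
      simpa using (hwmem m).1

theorem IsObedient.exists_isOREWith : ∃ e : Profile n, IsOREWith G B e ∧
    e.exAntePayoff G = ∑ k, G.prior.real (B k) * G.payoff k := by
  classical
  have := G.neZero
  have hcl := h.representation.isClosed
  have hmeas : ∀ k, MeasurableSet (B k) := fun k => (hcl k).measurableSet
  obtain ⟨a, p, ha, hp, honpath, hskeptic, hoptimal, hsupp⟩ := h.exists_response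
  obtain ⟨f, hf, hfspec⟩ := exists_measurable_greatest hmeas
  have hfmem : ∀ ω, ω ∈ B (f ω) := fun ω =>
    let ⟨i, hi⟩ := mem_iUnion.1 (h.representation.covers ▸ mem_univ ω)
    (hfspec ω i hi).1
  -- The value `⊤` for an empty set is never sent, since `f ω` indexes a set containing `ω`.
  let message : Fin n → Message := fun k =>
    if hk : (B k).Nonempty then ⟨⟨B k, (hcl k).isCompact⟩, hk⟩ else ⊤
  have hrec : ∀ ω, (message (f ω) : Set State) = B (f ω) := fun ω => by
    simp only [message, dif_pos (show (B (f ω)).Nonempty from ⟨ω, hfmem ω⟩)]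
    rfl
  have hsend : Measurable fun ω => message (f ω) := (measurable_of_finite message).comp hf
  let e : Profile n :=
    { sender := Kernel.deterministic _ hsend
      receiver := Kernel.deterministic a ha
      belief := p
      sender_markov := inferInstance
      receiver_markov := inferInstance
      belief_markov := hp }
  have hsender : ∀ ω, e.sender ω = Measure.dirac (message (f ω)) := fun ω =>
    Kernel.deterministic_apply hsend ω
  have hreceiver : ∀ m, e.receiver m = Measure.dirac (a m) := fun m =>
    Kernel.deterministic_apply ha m
  have hval : ∀ m, e.messageValue G m = G.payoff (a m) := by
    intro m
    simp only [Profile.messageValue, hreceiver]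
    rw [Finset.sum_eq_single (a m)]
    · simp [Measure.real]
    · intro i _ hi
      simp [Measure.real, Ne.symm hi]
    · simp
  have harec : ∀ ω, a (message (f ω)) = f ω := fun ω => (honpath _ _ (hrec ω)).1
  have hfiber : ∀ k, f ⁻¹' {k} =ᵐ[G.prior] B k := by
    intro k
    have hsub : f ⁻¹' {k} ⊆ B k := fun ω hω => (show f ω = k from hω) ▸ hfmem ω
    refine hsub.eventuallyLE.antisymm ?_
    rw [ae_le_set]
    refine measure_mono_null (t := ⋃ i ∈ ({k}ᶜ : Set (Fin n)), B i ∩ B k) (fun ω hω => ?_) ?_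
    · exact mem_iUnion₂.2 ⟨f ω, hω.2, hfmem ω, hω.1⟩
    · rw [measure_biUnion_null_iff (Set.to_countable _)]
      exact fun i hi => h.representation.overlap_null i k hi
  -- Only finitely many messages are sent, so both sides of Bayes' rule become finite sums compared
  -- on each `B k`.
  have hsum : ∀ (μ : Measure State) (φ : Fin n → ENNReal),
      ∫⁻ ω, φ (f ω) ∂μ = ∑ k, φ k * μ (f ⁻¹' {k}) := by
    intro μ φ
    rw [← lintegral_map (measurable_of_finite φ) hf, lintegral_fintype]
    simp [Measure.map_apply hf (measurableSet_singleton _)]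
  refine ⟨e, ⟨⟨fun ω => ?_, fun ω => ?_, fun m i hi => ?_, hsupp, ?_⟩, h.representation,
    fun i ω hω => ?_, fun i m hm => ?_⟩, ?_⟩
  · rw [hsender, ae_dirac_iff (by
      exact (measurableSet_inter_nonempty (isClosed_singleton (x := ω))).congr
        (by ext m; simp))]
    have := hfmem ω
    rw [← hrec] at this
    exact this
  · rw [hsender, ae_dirac_eq]
    intro m' hω
    obtain ⟨i, hi, hle⟩ := hskeptic m' ω hω
    rw [hval, hval, harec]
    exact G.payoff_strictMono.monotone (hle.trans (hfspec ω i hi).2)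
  · rw [hreceiver] at hi
    have : a m = i := by
      by_contra hne
      simp [hne] at hi
    exact this ▸ hoptimal m
  · have hσ : e.sender = Kernel.deterministic _ hsend := rfl
    have hπ : e.belief = p := rfl
    rw [hσ, hπ, Measure.deterministic_comp_eq_map, Measure.compProd_deterministic]
    have := Measure.isProbabilityMeasure_map (μ := G.prior) hsend.aemeasurable
    refine Measure.ext_prod fun {S A} hS hA => ?_
    have hpair : Measurable fun ω => (ω, message (f ω)) := measurable_id.prodMk hsend
    rw [Measure.compProd_apply_prod hS hA, ← lintegral_indicator hS,
      lintegral_map ((p.measurable_coe hA).indicator hS) hsend,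
      Measure.map_apply measurable_swap (hS.prod hA),
      Measure.map_apply hpair (measurable_swap (hS.prod hA))]
    have e1 : (fun ω => (ω, message (f ω))) ⁻¹' (Prod.swap ⁻¹' S ×ˢ A) =
        ((fun ω => message (f ω)) ⁻¹' S) ∩ A := by
      ext ω; simp [and_comm]
    have e2 : (G.prior.restrict A) ((fun ω => message (f ω)) ⁻¹' S) =
        ∫⁻ ω, S.indicator (fun _ => (1 : ENNReal)) (message (f ω)) ∂(G.prior.restrict A) := by
      rw [← lintegral_indicator_one (hsend hS)]
      rfl
    rw [e1, ← Measure.restrict_apply (hsend hS), e2,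
      hsum _ fun k => S.indicator (fun m => p m A) (message k),
      hsum _ fun k => S.indicator (fun _ => 1) (message k)]
    refine Finset.sum_congr rfl fun k _ => ?_
    by_cases hkS : message k ∈ S
    · simp only [hkS, indicator_of_mem, one_mul]
      rw [Measure.restrict_apply (hf (measurableSet_singleton k)), measure_congr (hfiber k),
        measure_congr ((hfiber k).inter (ae_eq_refl A))]
      by_cases hk : (B k).Nonempty
      · have hcoe : (message k : Set State) = B k := by
          simp only [message, dif_pos hk]; rfl
        rw [(honpath k _ hcoe).2, mul_comm, mul_comm, cond_mul_eq_inter (hmeas k)]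
      · rw [not_nonempty_iff_eq_empty.1 hk]; simp
    · simp [hkS]
  · have hfω : f ω = i := by
      have h1 := (hfspec ω i hω.1).2
      by_contra hne
      exact hω.2 (mem_iUnion₂.2 ⟨f ω, lt_of_le_of_ne h1 (Ne.symm hne), hfmem ω⟩)
    rw [hsender, Measure.dirac_apply' _ (measurableSet_coe_eq _)]
    have : message (f ω) ∈ {m : Message | (m : Set State) = B i} := by
      rw [mem_ofPred_eq, hrec, hfω]
    simp [this]
  · rw [hreceiver, (honpath i m hm).1]
    simp
  · have e1 : ∀ ω, ∫ m, e.messageValue G m ∂(e.sender ω) = G.payoff (f ω) := by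
      intro ω
      rw [hsender, integral_dirac, hval, harec]
    simp only [Profile.exAntePayoff, e1]
    rw [← integral_map (μ := G.prior) hf.aemeasurable
      (measurable_of_finite G.payoff).aestronglyMeasurable, integral_fintype .of_finite]
    refine Finset.sum_congr rfl fun k _ => ?_
    rw [map_measureReal_apply hf (measurableSet_singleton k), measureReal_congr (hfiber k)]
    rfl

end Game

/-! ### Full disclosure is feasible but not optimal -/

namespace Game

variable {n : ℕ} (G : Game n)

section Disclosure

variable {t : ℝ → Fin n} (ht : Measurable t)

/-- The choice of actions under full disclosure. -/
def disclosureKernel (ht : Measurable t) : Kernel State (Fin n) :=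
  Kernel.deterministic (fun ω : State => t ω) (ht.comp measurable_subtype_coe)

instance : IsMarkovKernel (disclosureKernel ht) := by
  unfold disclosureKernel; infer_instance

lemma share_disclosureKernel (k : Fin n) (ω : State) :
    share (disclosureKernel ht) k ω = if t ω = k then 1 else 0 := by
  rw [share, disclosureKernel, Kernel.deterministic_apply, Measure.real,
    Measure.dirac_apply]
  by_cases h : t ω = k <;> simp [h]

variable (hspec : ∀ x, 0 ≤ x →
    G.cutoff (t x).castSucc ≤ x ∧ ∀ k : Fin n, G.cutoff k.castSucc ≤ x → k ≤ t x)
include hspec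

lemma share_disclosureKernel_mul_nonneg (k : Fin n) (ω : State) :
    0 ≤ share (disclosureKernel ht) k ω * ((ω : ℝ) - G.cutoff k.castSucc) := by
  rw [share_disclosureKernel]
  by_cases h : t ω = k
  · simpa [h] using (h ▸ (hspec ω ω.2.1).1 : G.cutoff k.castSucc ≤ ω)
  · simp [h]

lemma isFeasible_disclosureKernel : G.IsFeasible (disclosureKernel ht) := by
  refine ⟨fun k => integral_nonneg (G.share_disclosureKernel_mul_nonneg ht hspec k),
    fun k => Eventually.of_forall fun ω hω => ?_⟩
  rw [share_disclosureKernel, if_neg]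
  rintro rfl
  by_cases hlast : (t ω : ℕ) + 1 < n
  · have := (hspec ω ω.2.1).2 ⟨(t ω : ℕ) + 1, hlast⟩ hω.le
    rw [Fin.le_def] at this
    simp at this
  · have : (t ω).succ = Fin.last n := Fin.ext (by have := (t ω).2; simp; omega)
    rw [this, G.cutoff_last] at hω
    exact absurd ω.2.2 (not_le.2 hω)

/-- Take the highest action whose lower cutoff is below one. States strictly between that cutoff and
one choose it and give it a positive surplus, so at an optimum no lower action would be chosen; yet
states below the cutoff, which is positive, choose lower actions. -/
theorem not_isValueMaximal_disclosureKernel (hG : ∃ k, 0 < G.cutoff k ∧ G.cutoff k < 1) :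
    ¬ G.IsValueMaximal (disclosureKernel ht) := by
  intro hmax
  obtain ⟨k₀, hk₀, hk₀'⟩ := hG
  have hne : k₀ ≠ Fin.last n := by
    rintro rfl
    exact absurd G.cutoff_last hk₀'.ne
  obtain ⟨k₁, rfl⟩ := Fin.exists_castSucc_eq.2 hne
  obtain ⟨k, hk, hkmax⟩ := (Finset.univ.filter fun k : Fin n => G.cutoff k.castSucc < 1).exists_max_image
    id ⟨k₁, by simpa using hk₀'⟩
  simp only [Finset.mem_filter, Finset.mem_univ, true_and, id] at hk hkmax
  have hkpos : 0 < G.cutoff k.castSucc :=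
    hk₀.trans_le (G.cutoff_mono (Fin.castSucc_le_castSucc_iff.2 (hkmax k₁ hk₀')))
  let c : State := ⟨G.cutoff k.castSucc, hkpos.le, hk.le⟩
  have htop : ∀ ω : State, c < ω → ω < 1 → t ω = k := fun ω h1 h2 =>
    le_antisymm (hkmax _ ((hspec ω ω.2.1).1.trans_lt (show (ω : ℝ) < 1 from h2)))
      ((hspec ω ω.2.1).2 k (le_of_lt h1))
  have hsurplus : 0 < G.surplus (disclosureKernel ht) k := by
    have hcont : Continuous fun ω : State => (ω : ℝ) - G.cutoff k.castSucc := by fun_prop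
    rw [surplus, integral_pos_iff_support_of_nonneg
      (G.share_disclosureKernel_mul_nonneg ht hspec k)
      (integrable_share_mul _ k hcont.measurable 1 (G.abs_state_sub_cutoff_le _))]
    have hc1 : c < 1 := hk
    refine (isOpen_Ioo.measure_pos G.prior (nonempty_Ioo.2 hc1)).trans_le
      (measure_mono fun ω hω => ?_)
    rw [Function.mem_support, share_disclosureKernel, if_pos (htop ω hω.1 hω.2), one_mul]
    exact (sub_pos.2 (show (c : ℝ) < ω from hω.1)).ne'
  have hzero : ∀ i < k, G.choosers (disclosureKernel ht) i = 0 := by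
    intro i hik
    by_contra hi
    exact hsurplus.ne' (hmax.surplus_eq_zero G hik hi)
  have hprior : G.prior (Iio c) = 0 := by
    rw [← G.sum_choosers (disclosureKernel ht), Measure.coe_finsetSum, Finset.sum_apply,
      Finset.sum_eq_zero_iff]
    intro i _
    rcases lt_or_ge i k with hik | hki
    · rw [hzero i hik]; rfl
    · rw [choosers, withDensity_apply _ measurableSet_Iio,
        setLIntegral_eq_zero_iff measurableSet_Iio
          (Kernel.measurable_coe _ (measurableSet_singleton i))]
      refine Eventually.of_forall fun ω hω => ?_
      have hne : t ω ≠ i := by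
        rintro rfl
        have := (G.cutoff_mono (Fin.castSucc_le_castSucc_iff.2 hki)).trans (hspec ω ω.2.1).1
        exact absurd hω (not_lt.2 this)
      simp [disclosureKernel, Kernel.deterministic_apply, hne]
  exact (isOpen_Iio.measure_pos G.prior ⟨0, show (0 : State) < c from hkpos⟩).ne' hprior

end Disclosure

/-! ### Conditional means and obedience at the optimum -/

section Optimum

variable {G} {κ : Kernel State (Fin n)} [IsMarkovKernel κ]

lemma value_eq_sum_choosers : G.value κ = ∑ k, (G.choosers κ k).real univ * G.payoff k := by
  rw [value, integral_finsetSum _ fun k _ => (integrable_share κ k).mul_const _]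
  refine Finset.sum_congr rfl fun k _ => ?_
  rw [← G.integral_choosers κ k fun _ => G.payoff k, integral_const, smul_eq_mul]

variable (h : G.IsLexOptimal κ)
include h

lemma IsLexOptimal.prior_support (k : Fin n) :
    G.prior (G.choosers κ k).support = G.choosers κ k univ := by
  rw [← Measure.restrict_apply_univ, h.restrict_support]

lemma IsLexOptimal.condMean_support (k : Fin n) :
    G.condMean (G.choosers κ k).support =
      (∫ ω : State, (ω : ℝ) ∂(G.choosers κ k)) / (G.choosers κ k).real univ := by
  rw [condMean, ProbabilityTheory.cond, integral_smul_measure, h.restrict_support, h.prior_support,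
    ENNReal.toReal_inv, smul_eq_mul, Measure.real, inv_mul_eq_div]

omit h in
lemma choosers_real_univ_pos {k : Fin n} (hk : G.choosers κ k ≠ 0) :
    0 < (G.choosers κ k).real univ :=
  ENNReal.toReal_pos (by simpa using hk) (measure_ne_top _ _)

omit h in
lemma surplus_eq_integral_sub (k : Fin n) : G.surplus κ k =
    ∫ ω : State, (ω : ℝ) ∂(G.choosers κ k) -
      G.cutoff k.castSucc * (G.choosers κ k).real univ := by
  rw [surplus_eq_integral_choosers, integral_sub (integrable_of_continuous (by fun_prop))
    (integrable_const _), integral_const, smul_eq_mul, mul_comm (G.cutoff _)]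

theorem IsLexOptimal.isObedient : G.IsObedient fun k => (G.choosers κ k).support where
  representation := h.isDeterministicRepresentation
  prior_ne_zero _ hk := by
    rw [h.prior_support]
    simpa using Measure.nonempty_support_iff.1 hk
  le_cutoff k := by
    have hclosed : IsClosed {ω : State | (ω : ℝ) ≤ G.cutoff k.succ} :=
      isClosed_le continuous_subtype_val continuous_const
    refine Measure.support_subset_of_isClosed (t := {ω : State | (ω : ℝ) ≤ G.cutoff k.succ})
      hclosed (mem_ae_iff.2 ?_)
    refine measure_mono_null (fun ω hω => ?_) (G.choosers_Ioi_cutoff κ h.1.1 k)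
    exact not_le.1 fun hle : (ω : ℝ) ≤ G.cutoff k.succ => hω hle
  cutoff_le_condMean k hk := by
    have hk := Measure.nonempty_support_iff.1 hk
    rw [h.condMean_support, le_div_iff₀ (choosers_real_univ_pos hk)]
    have := h.1.1.surplus_nonneg k
    rw [surplus_eq_integral_sub] at this
    linarith

lemma IsLexOptimal.condMean_eq_cutoff {i k : Fin n} (hik : i < k) (hi : G.choosers κ i ≠ 0)
    (hk : G.choosers κ k ≠ 0) :
    G.condMean (G.choosers κ k).support = G.cutoff k.castSucc := by
  rw [h.condMean_support, div_eq_iff (choosers_real_univ_pos hk).ne']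
  have := h.1.surplus_eq_zero G hik hi
  rw [surplus_eq_integral_sub] at this
  linarith

/-- The choosers lie weakly below the upper cutoff and have no atom there, so the inequality is
strict. -/
lemma IsLexOptimal.condMean_lt {k : Fin n} (hk : G.choosers κ k ≠ 0) :
    G.condMean (G.choosers κ k).support < G.cutoff k.succ := by
  rw [h.condMean_support, div_lt_iff₀ (choosers_real_univ_pos hk)]
  let A : Set State := {ω | (ω : ℝ) < G.cutoff k.succ}
  have hA : MeasurableSet A := measurableSet_lt measurable_subtype_coe measurable_const
  have hAc : G.choosers κ k Aᶜ = 0 := by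
    refine measure_mono_null (t := {ω : State | (ω : ℝ) = G.cutoff k.succ} ∪
      {ω : State | G.cutoff k.succ < (ω : ℝ)}) (fun ω hω => ?_) (measure_union_null
      (Set.Subsingleton.measure_zero (fun x hx y hy => Subtype.ext (hx.trans hy.symm)) _)
      (G.choosers_Ioi_cutoff κ h.1.1 k))
    have hle : G.cutoff k.succ ≤ (ω : ℝ) := not_lt.1 fun hlt => hω hlt
    exact hle.eq_or_lt.imp Eq.symm id
  have hA0 : G.choosers κ k A ≠ 0 := by
    intro h0
    have := measure_union_null h0 hAc
    rw [union_compl_self] at this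
    exact hk (Measure.measure_univ_eq_zero.1 this)
  have hpos : 0 < ∫ ω in A, (G.cutoff k.succ - (ω : ℝ)) ∂(G.choosers κ k) :=
    setIntegral_pos_of_forall_pos (by fun_prop) hA (fun ω hω => sub_pos.2 hω) hA0
  rw [Measure.restrict_eq_self_of_ae_mem (s := A) (mem_ae_iff.2 hAc), integral_sub (integrable_const _)
    (integrable_of_continuous (by fun_prop)), integral_const, smul_eq_mul] at hpos
  linarith

end Optimum

end Game

/-! ### Unraveling and the conclusion -/

namespace Profile

variable {n : ℕ} {e : Profile n} {G : Game n}

lemma IsUnraveling.inducedKernel_eq (h : e.IsUnraveling G) {t : ℝ → Fin n} (ht : Measurable t) :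
    e.inducedKernel t = Game.disclosureKernel ht := by
  have htm : Measurable fun m => t (e.posteriorMean m) := ht.comp e.measurable_posteriorMean
  ext1 ω
  rw [inducedKernel, Kernel.map_apply _ htm, h.2 ω, Measure.map_dirac' htm,
    h.1.posteriorMean_singleton, Game.disclosureKernel, Kernel.deterministic_apply]

end Profile

end

end VerifiableDisclosure

theorem proposition4 {n : ℕ} (G : VerifiableDisclosure.Game n)
    (hG : ∃ k, 0 < G.cutoff k ∧ G.cutoff k < 1) :
    ∃ e : VerifiableDisclosure.Profile n,
      e.IsSenderPreferred G ∧
      (∃ B : Fin n → Set VerifiableDisclosure.State,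
        VerifiableDisclosure.IsOREWith G B e ∧
        VerifiableDisclosure.IsLaminar B ∧
        ∃ j : Fin n, IsLeast {i | (interior (B i)).Nonempty} j ∧
          (B j).OrdConnected ∧
          (∀ k, j < k → VerifiableDisclosure.IsUnionOfDisjointIntervals (n - 1) (B k)) ∧
          G.condMean (B j) ∈ Set.Ico (G.cutoff j.castSucc) (G.cutoff j.succ) ∧
          (∀ k, j < k → (interior (B k)).Nonempty →
            G.condMean (B k) = G.cutoff k.castSucc)) ∧
      ∀ e' : VerifiableDisclosure.Profile n,
        e'.IsUnraveling G → e'.exAntePayoff G < e.exAntePayoff G := by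
  open VerifiableDisclosure in
  obtain ⟨t, ht, hspec⟩ := G.exists_highest_action
  obtain ⟨κ, hκ, hopt⟩ := G.exists_isLexOptimal
    ⟨_, inferInstance, G.isFeasible_disclosureKernel ht hspec⟩
  have hcover := hopt.isNestedCover
  have hobed := hopt.isObedient
  obtain ⟨e, he, hpay⟩ := hobed.exists_isOREWith
  have hvalue : e.exAntePayoff G = G.value κ := by
    rw [hpay, Game.value_eq_sum_choosers]
    simp only [Measure.real, hopt.prior_support]
  have hint : ∀ k, (interior (G.choosers κ k).support).Nonempty ↔ G.choosers κ k ≠ 0 := fun k =>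
    (hcover.interior_nonempty_iff k).trans Measure.nonempty_support_iff
  obtain ⟨j, hj, hjmin⟩ : ∃ j, IsLeast {i | (interior (G.choosers κ i).support).Nonempty} j := by
    obtain ⟨i, hi⟩ := Set.mem_iUnion.1 (hcover.covers ▸ Set.mem_univ (0 : State))
    obtain ⟨j, hj, hmin⟩ := (Set.toFinite
      {i | (interior (G.choosers κ i).support).Nonempty}).exists_minimal
      ⟨i, (hcover.interior_nonempty_iff i).2 ⟨0, hi⟩⟩
    exact ⟨j, hj, fun k hk => (le_total j k).elim id (hmin hk)⟩
  have hj0 := (hint j).1 hj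
  refine ⟨e, ⟨he.equilibrium, fun e' he' => ?_⟩, ⟨_, he, hcover.isLaminar, j, ⟨hj, hjmin⟩,
    hcover.ordConnected_of_forall_lt fun i hij => ?_, fun k hjk => ?_,
    ⟨hobed.cutoff_le_condMean j (Measure.nonempty_support_iff.2 hj0), hopt.condMean_lt hj0⟩,
    fun k hjk hk => hopt.condMean_eq_cutoff hjk hj0 ((hint k).1 hk)⟩, fun e' he' => ?_⟩
  · have := Profile.isMarkovKernel_inducedKernel (e := e') ht
    rw [hvalue]
    exact (he'.exAntePayoff_le ht hspec).trans
      (hopt.1.2 _ this (he'.isFeasible_inducedKernel ht hspec))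
  · by_contra hne
    exact absurd (hjmin ((hcover.interior_nonempty_iff i).2
      (Set.nonempty_iff_ne_empty.2 hne))) (not_le.2 hij)
  · refine (hcover.isUnionOfDisjointIntervals
      (fun i hi hne k hik x hx => hopt.1.support_leftmost G hi hne hik hx)
      (Nat.zero_lt_of_lt hjk)).mono ?_
    have := k.2
    omega
  -- If unraveling did at least as well, the disclosure kernel would attain the maximal relaxed
  -- value.
  · by_contra hle
    rw [not_lt, hvalue] at hle
    have hle' := hle.trans (he'.1.exAntePayoff_le ht hspec)
    rw [he'.inducedKernel_eq ht] at hle'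
    exact G.not_isValueMaximal_disclosureKernel ht hspec hG
      ⟨G.isFeasible_disclosureKernel ht hspec, fun κ' h1 h2 => (hopt.1.2 κ' h1 h2).trans hle'⟩
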